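/- Let $K$ be a field of characteristic zero, let $n\ge 1$ with $n\neq 2$, and let $R=K[X_1,\dots,X_n]$ be graded by $\deg X_i=\omega_i$, where $\omega_1,\dots,\omega_n$ are positive integers; put $\omega=\omega_1+\dots+\omega_n$. Let $f\in R$ be homogeneous and let $A=R/(f)$ be an isolated singularity, that is, $A_P$ is a regular local ring for every homogeneous prime ideal $P$ of $A$ other than the ideal generated by the images of $X_1,\dots,X_n$. Let $\partial=\partial_1,\dots,\partial_n$ be the partial derivatives, acting on $H^1_{(f)}(R)=R_f/R$, and let $H^{n-1}(\partial;H^1_{(f)}(R))$ be the $(n-1)$-th de Rham cohomology, i.e. the cohomology of the Koszul cochain complex of these commuting operators. Let $H^{n-1}(\partial(f);A)$ be the $(n-1)$-th Koszul cohomology of $A$ with respect to $\partial_1(f),\dots,\partial_n(f)$, graded through the identification $H^{n-1}=H_1$ with the first homology of the graded Koszul complex $\cdots\to\bigoplus_{k}A(-\deg f+\omega_k)\to A\to 0$ (where $M(l)_j=M_{l+j}$). Then there exist $K$-subspaces $\mathcal F_\nu$ $(\nu\ge 0)$ of $H^{n-1}(\partial;H^1_{(f)}(R))$ with $\mathcal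 F_0=0$, with $\mathcal F_{\nu-1}\subseteq\mathcal F_\nu$ for all $\nu\ge1$, and with $\mathcal F_\nu=H^{n-1}(\partial;H^1_{(f)}(R))$ for all sufficiently large $\nu$, and for every $\nu\ge 1$ there exists an injective $K$-linear map $$\eta_\nu:\ \mathcal F_\nu/\mathcal F_{\nu-1}\longrightarrow H^{n-1}(\partial(f);A)_{(\nu+1)\deg f-\omega}.$$ -/

import Mathlib

open MvPolynomial

noncomputable section

/-! ### The cochain complex of a family of commuting operators -/

section Koszul

variable {K M : Type*} [Field K] [AddCommGroup M] [Module K M] {n : ℕ}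

/-- The differential of the Koszul (de Rham) cochain complex of operators `T₁, …, Tₙ` on `M`.
A cochain `c` stands for `∑ S, c S • e_S`, where `e_S = e_{s₁} ∧ ⋯ ∧ e_{s_p}` for
`S = {s₁ < ⋯ < s_p}`, and the differential is `m • e_S ↦ ∑ j, T_j m • (e_j ∧ e_S)`. -/
def koszulD (T : Fin n → Module.End K M) :
    (Finset (Fin n) → M) →ₗ[K] (Finset (Fin n) → M) :=
  LinearMap.pi fun S => ∑ j ∈ S,
    ((-1 : ℤ) ^ (S.filter (fun k => k < j)).card) •
      ((T j).comp (LinearMap.proj (S.erase j)))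

variable (K M n) in
/-- Cochains of cohomological degree `p`: only subsets `S` with `p` elements occur. -/
def koszulCochains (p : ℕ) : Submodule K (Finset (Fin n) → M) where
  carrier := {c | ∀ S : Finset (Fin n), S.card ≠ p → c S = 0}
  add_mem' {a b} ha hb S hS := by simp [ha S hS, hb S hS]
  zero_mem' S _ := rfl
  smul_mem' r a ha S hS := by simp [ha S hS]

/-- Cocycles of cohomological degree `p`. -/
def koszulCocycles (T : Fin n → Module.End K M) (p : ℕ) : Submodule K (Finset (Fin n) → M) :=
  LinearMap.ker (koszulD T) ⊓ koszulCochains K M n p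

/-- The cohomology `H^p(T₁, …, Tₙ; M)`: cocycles of degree `p` modulo those that are
coboundaries. (The differential raises the degree by one, so a coboundary of degree `p` is the
differential of a cochain of degree `p - 1`, and is zero if `p = 0`.) -/
abbrev KoszulCohomology (T : Fin n → Module.End K M) (p : ℕ) : Type _ :=
  koszulCocycles T p ⧸ (LinearMap.range (koszulD T)).submoduleOf (koszulCocycles T p)

/-- Cochains that are homogeneous of degree `e`, when `M = ⨁ 𝒢 j` is graded over `ℤ` and `T_k` is
homogeneous of degree `s k`. The degrees are normalised as in the homological Koszul complex
`⋯ → ⨁ M(-s k) → M → 0`, whose term in homological degree `i`, namely `⨁ M(-∑ k ∈ U, s k)` over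
the `i`-element subsets `U`, is the term in cohomological degree `n - i`, with `U` corresponding to
the complementary subset `S = Uᶜ`. -/
def koszulCochainsOfDegree (𝒢 : ℤ → Submodule K M) (s : Fin n → ℤ) (e : ℤ) :
    Submodule K (Finset (Fin n) → M) where
  carrier := {c | ∀ S : Finset (Fin n), c S ∈ 𝒢 (e - ∑ k ∈ Sᶜ, s k)}
  add_mem' ha hb S := Submodule.add_mem _ (ha S) (hb S)
  zero_mem' _ := Submodule.zero_mem _
  smul_mem' r _ ha S := Submodule.smul_mem _ r (ha S)

/-- The graded component `H^p(T₁, …, Tₙ; M)_e`: the classes of homogeneous cocycles of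
degree `e`. -/
def koszulCohomologyOfDegree (T : Fin n → Module.End K M) (p : ℕ)
    (𝒢 : ℤ → Submodule K M) (s : Fin n → ℤ) (e : ℤ) : Submodule K (KoszulCohomology T p) :=
  ((koszulCochainsOfDegree 𝒢 s e).submoduleOf (koszulCocycles T p)).map
    ((LinearMap.range (koszulD T)).submoduleOf (koszulCocycles T p)).mkQ

end Koszul

/-! ### Derivations on a localization and on first local cohomology -/

section LocalCohomology

variable {K R : Type*} [Field K] [CommRing R] [Algebra K R]

variable (K) in
/-- The localization map `R → R_f` as a `K`-algebra homomorphism. -/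
def toAway (f : R) : R →ₐ[K] Localization.Away f :=
  IsScalarTower.toAlgHom K R (Localization.Away f)

/-- For a derivation `D` of `R`, the homomorphism `R → R_f[ε]`, `a ↦ a + D a • ε`. -/
def derivDual (D : Derivation K R R) (f : R) :
    R →ₐ[K] TrivSqZeroExt (Localization.Away f) (Localization.Away f) :=
  AlgHom.ofLinearMap
    ((TrivSqZeroExt.inlAlgHom K (Localization.Away f) (Localization.Away f)).toLinearMap ∘ₗ
        (toAway K f).toLinearMap +
      (TrivSqZeroExt.inrHom (Localization.Away f) (Localization.Away f)).restrictScalars K ∘ₗ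
        (toAway K f).toLinearMap ∘ₗ D.toLinearMap)
    (by ext <;> simp)
    (fun a b => by ext <;> simp [mul_comm])

theorem isUnit_derivDual (D : Derivation K R R) (f : R) (y : Submonoid.powers f) :
    IsUnit (derivDual D f y) := by
  rw [TrivSqZeroExt.isUnit_iff_isUnit_fst]
  have h : (derivDual D f y).fst = algebraMap R (Localization.Away f) y := by
    simp [derivDual, toAway]
  rw [h]
  exact IsLocalization.map_units _ y

/-- The extension `R_f → R_f[ε]` of `derivDual`. -/
def derivAwayDual (D : Derivation K R R) (f : R) :
    Localization.Away f →ₐ[K] TrivSqZeroExt (Localization.Away f) (Localization.Away f) :=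
  IsLocalization.liftAlgHom (M := Submonoid.powers f) (f := derivDual D f) (isUnit_derivDual D f)

theorem derivAwayDual_algebraMap (D : Derivation K R R) (f a : R) :
    derivAwayDual D f (algebraMap R (Localization.Away f) a) = derivDual D f a := by
  simp [derivAwayDual]

theorem fst_derivAwayDual (D : Derivation K R R) (f : R) (x : Localization.Away f) :
    (derivAwayDual D f x).fst = x := by
  have h : (TrivSqZeroExt.fstHom K (Localization.Away f) (Localization.Away f)).comp
      (derivAwayDual D f) = AlgHom.id K _ := by
    apply IsLocalization.algHom_ext (Submonoid.powers f)
    ext a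
    change (derivAwayDual D f (algebraMap R (Localization.Away f) a)).fst =
      algebraMap R (Localization.Away f) a
    rw [derivAwayDual_algebraMap]
    simp [derivDual, toAway]
  exact DFunLike.congr_fun h x

/-- The unique extension of a derivation `D` of `R` to a derivation of `R_f`
(given by the quotient rule). -/
def derivAway (D : Derivation K R R) (f : R) :
    Derivation K (Localization.Away f) (Localization.Away f) :=
  Derivation.mk'
    ((TrivSqZeroExt.sndHom (Localization.Away f) (Localization.Away f)).restrictScalars K ∘ₗ
      (derivAwayDual D f).toLinearMap)
    (fun a b => by simp [fst_derivAwayDual, mul_comm])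

theorem derivAway_algebraMap (D : Derivation K R R) (f a : R) :
    derivAway D f (algebraMap R (Localization.Away f) a) =
      algebraMap R (Localization.Away f) (D a) := by
  change (derivAwayDual D f (algebraMap R (Localization.Away f) a)).snd = _
  rw [derivAwayDual_algebraMap]
  simp [derivDual, toAway]
  exact (Algebra.algebraMap_eq_smul_one _).symm

variable (K) in
/-- The first local cohomology module `H^1_{(f)}(R)` as the cokernel of `R → R_f`, that is, the
first cohomology of the Čech complex `0 → R → R_f → 0` of `f`. -/
abbrev LocalCohomologyOne (f : R) : Type _ :=
  Localization.Away f ⧸ LinearMap.range (toAway K f).toLinearMap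

/-- The operator induced by a derivation `D` of `R` on `H^1_{(f)}(R)`. -/
def derivLocalCohomologyOne (D : Derivation K R R) (f : R) :
    Module.End K (LocalCohomologyOne K f) :=
  Submodule.mapQ _ _ (derivAway D f).toLinearMap (by
    rintro _ ⟨a, rfl⟩
    exact ⟨D a, (derivAway_algebraMap D f a).symm⟩)

end LocalCohomology

/-! ### Graded hypersurface rings -/

section Hypersurface

variable {K : Type*} [Field K] {n : ℕ}

/-- The hypersurface ring `A = R/(f)`, where `R = K[X₁, …, Xₙ]`. -/
abbrev HypersurfaceRing (f : MvPolynomial (Fin n) K) : Type _ :=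
  MvPolynomial (Fin n) K ⧸ Ideal.span {f}

/-- The component `A_e` of `A = R/(f)`, for `deg X_i = w i` and `e` an integer: the classes of
the homogeneous polynomials of degree `e`. -/
def HypersurfaceRing.component (w : Fin n → ℕ) (f : MvPolynomial (Fin n) K) (e : ℤ) :
    Submodule K (HypersurfaceRing f) :=
  (weightedHomogeneousSubmodule K (fun i => (w i : ℤ)) e).map
    (Ideal.Quotient.mkₐ K (Ideal.span {f})).toLinearMap

attribute [local instance] MvPolynomial.weightedGradedAlgebra in
/-- `A = R/(f)` is an isolated singularity: the local ring `A_P` is regular for each homogeneous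
prime ideal `P` of `A` other than the ideal generated by the classes of `X₁, …, Xₙ`. -/
def HypersurfaceRing.IsIsolatedSingularity (w : Fin n → ℕ) (f : MvPolynomial (Fin n) K) : Prop :=
  ∀ (P : Ideal (HypersurfaceRing f)) [P.IsPrime],
    (P.comap (Ideal.Quotient.mk (Ideal.span {f}))).IsHomogeneous
      (weightedHomogeneousSubmodule K w) →
    P ≠ Ideal.span (Set.range fun i => Ideal.Quotient.mk (Ideal.span {f}) (X i)) →
    IsRegularLocalRing (Localization.AtPrime P)

/-- The operators `∂₁, …, ∂ₙ` on `H^1_{(f)}(R)`. -/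
def deRhamOperators (f : MvPolynomial (Fin n) K) :
    Fin n → Module.End K (LocalCohomologyOne K f) :=
  fun i => derivLocalCohomologyOne (pderiv i) f

/-- Multiplication by `∂₁(f), …, ∂ₙ(f)` on `A = R/(f)`. -/
def jacobianOperators (f : MvPolynomial (Fin n) K) :
    Fin n → Module.End K (HypersurfaceRing f) :=
  fun i => LinearMap.mulLeft K (Ideal.Quotient.mk (Ideal.span {f}) (pderiv i f))

end Hypersurface

end

/-! ### Jacobian criterion for hypersurfaces -/

section JacobianCriterion

open IsLocalRing

/-! The filtration is by order of pole. A class in degree `n - 1` is a vector `a i / f ^ ν` whose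
divergence vanishes modulo polynomials. Contraction with the Euler vector field makes every closed
homogeneous vector of nonzero degree exact (`cochainOfVector_polarVector_mem_range`), so only degree
zero matters, and `F ν` consists of the classes of degree-zero closed vectors with denominator `f ^
ν`.

For `ν ≥ 1`, closedness modulo `f` reads `f ∣ ν * ∑ a i * ∂ᵢ f`. Hence in characteristic zero the
residues of the `a i` form a Koszul cycle over `A`, in the degree predicted by the theorem. If this
cycle is a boundary, then `a i = ∑ⱼ β i j * ∂ⱼ f + f * c i` with `β` skew, and subtracting the
coboundary of a multiple of `β / f ^ (ν - 1)` lowers the pole order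
(`poleClass_mem_range_of_mem_jacobianBoundaries`). For `ν = 1` that multiple does not exist, but `β
i j` then has degree `w i + w j - ω`, negative for `i ≠ j` because `n ≠ 2`, so `β = 0`. Thus vectors
with zero residue class land in `F (ν - 1)`, and linear algebra gives the injection.

The filtration stops because the ideal of `f` and its partial derivatives annihilates the Koszul
homology and, by the Jacobian criterion, contains a power of the ideal of the variables. By
Artin–Rees, homogeneous cycles of high degree are boundaries, so high pole orders can always be
lowered. -/

theorem Derivation.algebraMap_mvPolynomial_eq_sum_pderiv {K σ S M : Type*} [Field K] [Fintype σ]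
    [CommRing S] [Algebra K S] [Algebra (MvPolynomial σ K) S] [IsScalarTower K (MvPolynomial σ K) S]
    [AddCommGroup M] [Module K M] [Module S M]
    (D : Derivation K S M) (p : MvPolynomial σ K) :
    D (algebraMap _ S p) = ∑ i, algebraMap _ S (pderiv i p) •
      D (algebraMap (MvPolynomial σ K) S (X i)) := by
  classical
  induction p using MvPolynomial.induction_on with
  | C a =>
    have : algebraMap (MvPolynomial σ K) S (C a) = algebraMap K S a :=
      (IsScalarTower.algebraMap_apply K (MvPolynomial σ K) S a).symm
    simp [this]
  | add p q hp hq => simp [hp, hq, add_smul, Finset.sum_add_distrib]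
  | mul_X p j hp =>
    simp only [map_mul, Derivation.leibniz, hp, pderiv_X, smul_eq_mul, map_add, add_smul,
      Finset.sum_add_distrib, mul_smul, Finset.smul_sum, Pi.single_apply, apply_ite, map_one,
      map_zero, ite_smul, zero_smul, smul_zero, Finset.sum_ite_eq, Finset.mem_univ, if_true,
      one_smul]

/-- Over a field of characteristic zero, if a polynomial in a prime ideal `P` has all its partial
derivatives in `P`, then it vanishes to order two at `P`. -/
theorem MvPolynomial.algebraMap_mem_maximalIdeal_sq_of_pderiv_mem {K : Type*} [Field K] [CharZero K]
    {n : ℕ} (P : Ideal (MvPolynomial (Fin n) K)) [P.IsPrime] {f : MvPolynomial (Fin n) K}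
    (hf : f ∈ P) (hdf : ∀ i, pderiv i f ∈ P) :
    algebraMap _ (Localization.AtPrime P) f ∈ maximalIdeal (Localization.AtPrime P) ^ 2 := by
  set S := Localization.AtPrime P
  set k := ResidueField S
  have hsurj : Function.Surjective (algebraMap S k) := residue_surjective
  have hS : Algebra.EssFiniteType K S := inferInstance
  have : Algebra.EssFiniteType K k := by
    have : Algebra.FiniteType S k := Algebra.FiniteType.of_surjective (Algebra.ofId S k) hsurj
    exact Algebra.EssFiniteType.comp K S k
  -- In characteristic zero the residue field is formally smooth over `K`, so the cotangent space of
  -- `S` embeds in `k ⊗ Ω[S/K]`. It remains to see that `df` vanishes there, which holds since `df =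
  -- ∑ ∂ᵢ f dXᵢ`.
  have hk : Algebra.FormallySmooth K k := inferInstance
  have hinj := (Algebra.FormallySmooth.kerCotangentToTensor_injective_iff (R := K) hsurj).2
    hk.subsingleton_h1Cotangent
  have hker : RingHom.ker (algebraMap S k) = maximalIdeal S := ker_residue
  have hres : ∀ g ∈ P, algebraMap S k (algebraMap _ S g) = 0 := fun g hg => by
    rw [← RingHom.mem_ker, hker]
    exact (IsLocalization.AtPrime.to_map_mem_maximal_iff S P g).2 hg
  have hfk : algebraMap _ S f ∈ RingHom.ker (algebraMap S k) := hres f hf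
  have h0 : KaehlerDifferential.kerCotangentToTensor K S k
      (Ideal.toCotangent _ ⟨algebraMap _ S f, hfk⟩) = 0 := by
    rw [KaehlerDifferential.kerCotangentToTensor_toCotangent]
    rw [Derivation.algebraMap_mvPolynomial_eq_sum_pderiv, TensorProduct.tmul_sum]
    refine Finset.sum_eq_zero fun i _ => ?_
    rw [← TensorProduct.smul_tmul, ← Algebra.algebraMap_eq_smul_one, hres _ (hdf i), TensorProduct.zero_tmul]
  have := hinj (h0.trans (map_zero _).symm)
  rw [Ideal.toCotangent_eq_zero] at this
  rw [← hker]
  exact this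

/-- A quotient `B` of a Noetherian local domain `S` by a nonzero ideal contained in the square of
the maximal ideal is not regular. -/
theorem not_isRegularLocalRing_of_ker_le_sq {S B : Type*} [CommRing S] [IsDomain S]
    [IsLocalRing S] [IsNoetherianRing S] [CommRing B] (φ : S →+* B)
    (hφ : Function.Surjective φ) (hker : RingHom.ker φ ≤ maximalIdeal S ^ 2)
    {r : S} (hr : r ≠ 0) (hr0 : φ r = 0) : ¬ IsRegularLocalRing B := by
  classical
  intro hB
  -- Contradiction sought: `dim B + 1 ≤ dim S ≤ embdim S ≤ embdim B = dim B`.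
  have hdim := ringKrullDim_succ_le_of_surjective φ hφ (mem_nonZeroDivisors_of_ne_zero hr) hr0
  have hle := ringKrullDim_le_spanFinrank_maximalIdeal S
  obtain ⟨s, hs, hspan⟩ := Submodule.FG.exists_span_finset_card_eq_spanFinrank
    (IsNoetherian.noetherian (maximalIdeal B))
  have hloc : IsLocalHom φ := hφ.isLocalHom
  choose g hg using hφ
  have hcomap : (maximalIdeal B).comap φ = maximalIdeal S := ((local_hom_TFAE φ).out 0 4).1 hloc
  -- Nakayama: as the kernel lies in the square of the maximal ideal, lifts of generators still
  -- generate.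
  have hgen : maximalIdeal S ≤ Submodule.span S (s.image g : Set S) := by
    refine Submodule.le_of_le_smul_of_le_jacobson_bot (I := maximalIdeal S)
      (IsNoetherian.noetherian _) (maximalIdeal_le_jacobson ⊥) ?_
    intro x hx
    have hx' : φ x ∈ Submodule.span B (s : Set B) := by
      rw [hspan]; rw [← hcomap] at hx; exact hx
    have hmap : Ideal.map φ (Ideal.span (s.image g : Set S)) = Submodule.span B (s : Set B) := by
      rw [Ideal.map_span]
      congr 1
      ext b
      simp [hg]
    rw [← hmap] at hx'
    obtain ⟨y, hy, hyx⟩ := (Ideal.mem_map_iff_of_surjective φ (fun b => ⟨g b, hg b⟩)).1 hx'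
    have hxy : x - y ∈ maximalIdeal S ^ 2 := hker (by simp [RingHom.mem_ker, hyx])
    have : x = y + (x - y) := by ring
    rw [this, smul_eq_mul, ← pow_two]
    exact Submodule.add_mem_sup hy hxy
  have heq : Submodule.span S (s.image g : Set S) = maximalIdeal S := by
    refine le_antisymm (Submodule.span_le.2 ?_) hgen
    intro x hx
    simp only [Finset.coe_image, Set.mem_image, Finset.mem_coe] at hx
    obtain ⟨b, hb, rfl⟩ := hx
    rw [← hcomap]
    change φ (g b) ∈ maximalIdeal B
    rw [hg, ← hspan]
    exact Submodule.subset_span hb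
  have hcard : (maximalIdeal S).spanFinrank ≤ (maximalIdeal B).spanFinrank := by
    rw [← heq, ← hs]
    refine (Submodule.spanFinrank_span_le_ncard_of_finite (Finset.finite_toSet _)).trans ?_
    rw [Set.ncard_coe_finset]
    exact Finset.card_image_le
  have hreg := hB.spanFinrank_maximalIdeal
  rw [← hreg] at hdim
  have h1 : (((maximalIdeal B).spanFinrank + 1 : ℕ) : WithBot ℕ∞) ≤
      ((maximalIdeal S).spanFinrank : ℕ) := by
    push_cast
    exact hdim.trans hle
  have h2 : (maximalIdeal B).spanFinrank + 1 ≤ (maximalIdeal S).spanFinrank := by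
    exact_mod_cast h1
  omega

/-- The Jacobian criterion: if the hypersurface ring of a nonzero `f` is regular at a prime, then
some partial derivative of `f` does not vanish there. -/
theorem HypersurfaceRing.exists_pderiv_notMem_of_isRegularLocalRing {K : Type*} [Field K]
    [CharZero K] {n : ℕ} {f : MvPolynomial (Fin n) K} (hf : f ≠ 0) (P : Ideal (HypersurfaceRing f))
    [P.IsPrime] (hP : IsRegularLocalRing (Localization.AtPrime P)) :
    ∃ i, Ideal.Quotient.mk (Ideal.span {f}) (pderiv i f) ∉ P := by
  by_contra! h
  set π := Ideal.Quotient.mk (Ideal.span {f})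
  have hπ : Function.Surjective π := Ideal.Quotient.mk_surjective
  let Q := P.comap π
  have hT : Submonoid.map π Q.primeCompl = P.primeCompl := by
    ext x
    constructor
    · rintro ⟨y, hy, rfl⟩
      exact hy
    · obtain ⟨y, rfl⟩ := hπ x
      exact fun hx => ⟨y, hx, rfl⟩
  have hloc : IsLocalization (Submonoid.map π Q.primeCompl) (Localization.AtPrime P) := by
    rw [hT]
    infer_instance
  have hf0 : π f = 0 := Ideal.Quotient.eq_zero_iff_mem.2 (Ideal.mem_span_singleton_self f)
  have hsq := MvPolynomial.algebraMap_mem_maximalIdeal_sq_of_pderiv_mem Q (f := f)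
    (by simp [Q, Ideal.mem_comap, hf0]) h
  refine not_isRegularLocalRing_of_ker_le_sq
    (IsLocalization.map (M := Q.primeCompl) (S := Localization.AtPrime Q)
      (T := P.primeCompl) (Localization.AtPrime P) π
      (fun y hy => hT ▸ Submonoid.mem_map_of_mem π hy)) ?_ ?_
    (r := algebraMap _ _ f) ?_ ?_ hP
  · exact IsLocalization.map_surjective_of_surjective Q.primeCompl (Localization.AtPrime Q)
      (Localization.AtPrime P) hπ
  · rw [IsLocalization.ker_map (Localization.AtPrime P) π hT, Ideal.mk_ker, Ideal.map_span,
      Ideal.span_le]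
    simpa using hsq
  · simpa using (IsLocalization.to_map_eq_zero_iff (Localization.AtPrime Q)
      Q.primeCompl_le_nonZeroDivisors).not.2 hf
  · rw [IsLocalization.map_eq, hf0, map_zero]

attribute [local instance] MvPolynomial.weightedGradedAlgebra in
/-- For an isolated singularity, the ideal generated by `f` and its partial derivatives contains a
power of the ideal generated by the variables. -/
theorem HypersurfaceRing.IsIsolatedSingularity.exists_pow_idealOfVars_le {K : Type*} [Field K]
    [CharZero K] {n : ℕ} {w : Fin n → ℕ} {f : MvPolynomial (Fin n) K} {d : ℕ} (hf0 : f ≠ 0)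
    (hf : IsWeightedHomogeneous w f d) (hA : HypersurfaceRing.IsIsolatedSingularity w f) :
    ∃ N, idealOfVars (Fin n) K ^ N ≤
      Ideal.span (insert f (Set.range fun i => pderiv i f)) := by
  apply Ideal.exists_pow_le_of_le_radical_of_fg _ (idealOfVars_fg _ _)
  set J := Ideal.span (insert f (Set.range fun i => pderiv i f))
  have hJhom : J.IsHomogeneous (weightedHomogeneousSubmodule K w) := by
    apply Ideal.homogeneous_span
    rintro x (rfl | ⟨i, rfl⟩)
    · exact ⟨d, hf⟩
    · by_cases hi : w i ≤ d
      · exact ⟨d - w i, hf.pderiv (by omega)⟩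
      -- A variable heavier than `d` cannot occur in `f`.
      · have : pderiv i f = 0 := by
          have hnot : i ∉ f.vars := by
            rw [mem_vars_iff_mem_support]
            rintro ⟨m, hm, hmi⟩
            have h1 := hf (mem_support_iff.1 hm)
            have h2 := Finsupp.le_weight_of_ne_zero' w (by simpa using hmi : m i ≠ 0)
            omega
          exact pderiv_eq_zero_of_notMem_vars hnot
        exact ⟨0, by simp [this]⟩
  rw [Ideal.radical_eq_sInf]
  refine le_sInf fun Q ⟨hJQ, hQ⟩ => ?_
  -- The hypothesis only tests homogeneous primes, so `Q` is replaced by its homogeneous core, which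
  -- is still prime and still contains the homogeneous ideal `J`.
  set C := (Q.homogeneousCore (weightedHomogeneousSubmodule K w)).toIdeal
  have hC : C.IsPrime := hQ.homogeneousCore
  have hCQ : C ≤ Q := Ideal.toIdeal_homogeneousCore_le _ Q
  have hJC : J ≤ C := by
    have := Ideal.homogeneousCore_mono (weightedHomogeneousSubmodule K w) hJQ
    intro x hx
    apply this
    rw [← hJhom.toIdeal_homogeneousCore_eq_self] at hx
    exact hx
  set π := Ideal.Quotient.mk (Ideal.span {f})
  have hπ : Function.Surjective π := Ideal.Quotient.mk_surjective
  have hfC : Ideal.span {f} ≤ C :=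
    (Ideal.span_mono (by simp)).trans hJC
  have hcomap : (C.map π).comap π = C := by
    rw [Ideal.comap_map_of_surjective π hπ, ← RingHom.ker_eq_comap_bot, Ideal.mk_ker,
      sup_eq_left.2 hfC]
  have hprime : (C.map π).IsPrime :=
    Ideal.map_isPrime_of_surjective hπ (by rwa [Ideal.mk_ker])
  by_cases hm : C.map π = Ideal.span (Set.range fun i => π (X i))
  · refine le_trans ?_ hCQ
    rw [← hcomap, hm, idealOfVars, Ideal.span_le]
    rintro _ ⟨i, rfl⟩
    exact Ideal.subset_span ⟨i, rfl⟩
  · exfalso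
    have hreg := hA (C.map π) (by
      rw [hcomap]; exact (Q.homogeneousCore (weightedHomogeneousSubmodule K w)).isHomogeneous) hm
    obtain ⟨i, hi⟩ := exists_pderiv_notMem_of_isRegularLocalRing hf0 (C.map π) hreg
    exact hi (Ideal.mem_map_of_mem π (hJC (Ideal.subset_span (by simp))))

end JacobianCriterion

noncomputable section

/-! ### Koszul cohomology in degree `n - 1`: divergence-free vectors modulo divergences of skew
arrays -/

section KoszulCodimensionOne

variable {K M : Type*} [Field K] [AddCommGroup M] [Module K M] {n : ℕ}

variable (K M n) in
/-- The cochain of degree `n - 1` with component `(-1) ^ i • v i` at the complement of `i`. -/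
def cochainOfVector : (Fin n → M) →ₗ[K] (Finset (Fin n) → M) :=
  LinearMap.pi fun S => ∑ i, if S = {i}ᶜ then ((-1 : ℤ) ^ (i : ℕ)) • LinearMap.proj i else 0

theorem cochainOfVector_compl (v : Fin n → M) (i : Fin n) :
    cochainOfVector K M n v {i}ᶜ = ((-1 : ℤ) ^ (i : ℕ)) • v i := by
  simp only [cochainOfVector, LinearMap.pi_apply, LinearMap.sum_apply]
  rw [Finset.sum_eq_single i]
  · simp
  · intro j _ hj
    have : ¬ ({i}ᶜ : Finset (Fin n)) = {j}ᶜ := by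
      simpa [compl_inj_iff] using hj.symm
    simp [this]
  · simp

theorem cochainOfVector_of_ne (v : Fin n → M) {S : Finset (Fin n)} (hS : ∀ i, S ≠ {i}ᶜ) :
    cochainOfVector K M n v S = 0 := by
  simp [cochainOfVector, hS]

theorem cochainOfVector_mem (v : Fin n → M) :
    cochainOfVector K M n v ∈ koszulCochains K M n (n - 1) := by
  intro S hS
  refine cochainOfVector_of_ne v fun i hi => hS ?_
  simp [hi, Finset.card_compl]

theorem exists_eq_cochainOfVector (hn : 1 ≤ n) {c : Finset (Fin n) → M}
    (hc : c ∈ koszulCochains K M n (n - 1)) : ∃ v, c = cochainOfVector K M n v := by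
  refine ⟨fun i => ((-1 : ℤ) ^ (i : ℕ)) • c {i}ᶜ, funext fun S => ?_⟩
  by_cases hS : ∃ i, S = {i}ᶜ
  · obtain ⟨i, rfl⟩ := hS
    rw [cochainOfVector_compl, smul_smul, ← mul_pow]
    simp
  · push Not at hS
    rw [cochainOfVector_of_ne _ hS]
    apply hc
    intro hcard
    have : Sᶜ.card = 1 := by
      rw [Finset.card_compl, hcard, Fintype.card_fin]; omega
    obtain ⟨i, hi⟩ := Finset.card_eq_one.1 this
    exact hS i (by rw [← hi, compl_compl])

theorem Finset.eq_univ_of_erase_eq_compl_singleton {S : Finset (Fin n)} {i j : Fin n} (hj : j ∈ S)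
    (h : S.erase j = {i}ᶜ) : S = Finset.univ := by
  have hji : j = i := by
    by_contra hne
    have : j ∈ S.erase j := by rw [h]; simpa using hne
    simp at this
  subst hji
  rw [← Finset.insert_erase hj, h]
  ext k
  simp

theorem koszulD_cochainOfVector_univ (T : Fin n → Module.End K M) (v : Fin n → M) :
    koszulD T (cochainOfVector K M n v) Finset.univ = ∑ i, T i (v i) := by
  simp only [koszulD, LinearMap.pi_apply, LinearMap.sum_apply, LinearMap.smul_apply,
    LinearMap.comp_apply, LinearMap.proj_apply]
  refine Finset.sum_congr rfl fun i _ => ?_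
  have h1 : (Finset.univ : Finset (Fin n)).erase i = {i}ᶜ := by ext; simp
  have h2 : (Finset.univ.filter fun k => k < i).card = (i : ℕ) := by
    rw [Finset.filter_gt_eq_Iio, Fin.card_Iio]
  rw [h1, h2, cochainOfVector_compl, map_zsmul, smul_smul, ← mul_pow]
  simp

theorem koszulD_cochainOfVector_of_ne (T : Fin n → Module.End K M) (v : Fin n → M)
    {S : Finset (Fin n)} (hS : S ≠ Finset.univ) :
    koszulD T (cochainOfVector K M n v) S = 0 := by
  simp only [koszulD, LinearMap.pi_apply, LinearMap.sum_apply, LinearMap.smul_apply,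
    LinearMap.comp_apply, LinearMap.proj_apply]
  refine Finset.sum_eq_zero fun j hj => ?_
  rw [cochainOfVector_of_ne _ fun i h => hS (Finset.eq_univ_of_erase_eq_compl_singleton hj h)]
  simp

/-- The divergence `v ↦ ∑ i, T i (v i)` with respect to a family of operators. -/
def operatorDiv (T : Fin n → Module.End K M) : (Fin n → M) →ₗ[K] M :=
  ∑ i, (T i).comp (LinearMap.proj i)

theorem operatorDiv_apply (T : Fin n → Module.End K M) (v : Fin n → M) :
    operatorDiv T v = ∑ i, T i (v i) := by
  simp [operatorDiv]

theorem cochainOfVector_mem_koszulCocycles {T : Fin n → Module.End K M} {v : Fin n → M}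
    (hv : operatorDiv T v = 0) : cochainOfVector K M n v ∈ koszulCocycles T (n - 1) := by
  refine ⟨?_, cochainOfVector_mem v⟩
  change koszulD T _ = 0
  funext S
  by_cases hS : S = Finset.univ
  · rw [hS, koszulD_cochainOfVector_univ, ← operatorDiv_apply, hv]; rfl
  · rw [koszulD_cochainOfVector_of_ne T v hS]; rfl

/-- The cohomology class in degree `n - 1` of a vector with vanishing divergence. -/
def koszulClass (T : Fin n → Module.End K M) :
    LinearMap.ker (operatorDiv T) →ₗ[K] KoszulCohomology T (n - 1) :=
  ((LinearMap.range (koszulD T)).submoduleOf (koszulCocycles T (n - 1))).mkQ ∘ₗ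
    LinearMap.restrict (cochainOfVector K M n)
      (fun _ hv => cochainOfVector_mem_koszulCocycles (LinearMap.mem_ker.1 hv))

theorem koszulClass_surjective (hn : 1 ≤ n) (T : Fin n → Module.End K M) :
    Function.Surjective (koszulClass T) := by
  intro x
  obtain ⟨⟨c, hc⟩, rfl⟩ := Submodule.mkQ_surjective _ x
  obtain ⟨v, rfl⟩ := exists_eq_cochainOfVector hn hc.2
  refine ⟨⟨v, ?_⟩, rfl⟩
  rw [LinearMap.mem_ker, operatorDiv_apply, ← koszulD_cochainOfVector_univ,
    LinearMap.mem_ker.1 hc.1]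
  rfl

theorem koszulClass_eq_zero_iff {T : Fin n → Module.End K M}
    (v : LinearMap.ker (operatorDiv T)) :
    koszulClass T v = 0 ↔ cochainOfVector K M n v ∈ LinearMap.range (koszulD T) := by
  simp only [koszulClass, LinearMap.comp_apply, Submodule.mkQ_apply, Submodule.Quotient.mk_eq_zero]
  exact Submodule.mem_comap

/-- The sign relating cochains of degree `n - 2` to skew-symmetric arrays. -/
def skewSign (i j : Fin n) : ℤ :=
  if i < j then -(-1) ^ ((i : ℕ) + j) else (-1) ^ ((i : ℕ) + j)

theorem skewSign_swap {i j : Fin n} (h : i ≠ j) : skewSign j i = -skewSign i j := by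
  rcases lt_or_gt_of_ne h with h | h <;> simp [skewSign, h, h.not_gt, add_comm]

theorem skewSign_mul_self (i j : Fin n) : skewSign i j * skewSign i j = 1 := by
  unfold skewSign
  split_ifs <;> simp [← mul_pow]

/-- Omitting `i` lowers the number of indices below `j` by one exactly when `i < j`; this is the
case distinction in `skewSign`. -/
theorem neg_one_pow_card_filter_compl {i j : Fin n} (h : i ≠ j) :
    (-1 : ℤ) ^ ((({i}ᶜ : Finset (Fin n)).filter fun k => k < j).card) =
      (-1) ^ (i : ℕ) * skewSign i j := by
  have hf : ({i}ᶜ : Finset (Fin n)).filter (fun k => k < j) = (Finset.Iio j).erase i := by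
    ext k; simp
  rw [hf, skewSign]
  rcases lt_or_gt_of_ne h with h | h
  · rw [Finset.card_erase_of_mem (by simpa using h), Fin.card_Iio, if_pos h, mul_neg, ← pow_add]
    have : 1 ≤ (j : ℕ) := by have := Fin.lt_def.1 h; omega
    obtain ⟨m, hm⟩ := Nat.exists_eq_add_of_le' this
    rw [hm, Nat.add_sub_cancel, show (i : ℕ) + (i + (m + 1)) = 2 * i + m + 1 by ring, pow_succ,
      pow_add, pow_mul]
    simp
  · rw [Finset.erase_eq_of_notMem (by simpa using h.le), Fin.card_Iio, if_neg h.not_gt, ← pow_add,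
      show (i : ℕ) + (i + j) = 2 * i + j by ring, pow_add, pow_mul]
    simp

theorem koszulD_apply_compl (T : Fin n → Module.End K M) (b : Finset (Fin n) → M) (i : Fin n) :
    koszulD T b {i}ᶜ = ((-1 : ℤ) ^ (i : ℕ)) •
      ∑ j ∈ ({i}ᶜ : Finset (Fin n)), T j (skewSign i j • b {i, j}ᶜ) := by
  simp only [koszulD, LinearMap.pi_apply, LinearMap.sum_apply, LinearMap.smul_apply,
    LinearMap.comp_apply, LinearMap.proj_apply, Finset.smul_sum]
  refine Finset.sum_congr rfl fun j hj => ?_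
  have hij : i ≠ j := by simpa [eq_comm] using hj
  have h1 : ({i}ᶜ : Finset (Fin n)).erase j = {i, j}ᶜ := by ext k; simp; tauto
  rw [h1, neg_one_pow_card_filter_compl hij, map_zsmul, smul_smul]

/-- The diagonal condition is listed separately because skewness does not imply it in characteristic
two. -/
theorem exists_skew_of_mem_range {T : Fin n → Module.End K M} {v : Fin n → M}
    (h : cochainOfVector K M n v ∈ LinearMap.range (koszulD T)) :
    ∃ β : Fin n → Fin n → M, (∀ i j, β i j = -β j i) ∧ (∀ i, β i i = 0) ∧
      ∀ i, v i = ∑ j, T j (β i j) := by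
  obtain ⟨b, hb⟩ := h
  refine ⟨fun i j => if i = j then 0 else skewSign i j • b {i, j}ᶜ, ?_, by simp, fun i => ?_⟩
  · intro i j
    by_cases hij : i = j
    · simp [hij]
    · simp [hij, Ne.symm hij, skewSign_swap hij, Finset.pair_comm j i]
  · have := congr_fun hb {i}ᶜ
    rw [koszulD_apply_compl, cochainOfVector_compl] at this
    have h2 := congr_arg (fun x => ((-1 : ℤ) ^ (i : ℕ)) • x) this
    simp only [smul_smul, ← mul_pow, neg_one_mul, neg_neg, one_pow, one_smul] at h2
    rw [← h2, ← Finset.sum_subset (Finset.subset_univ ({i}ᶜ : Finset (Fin n)))]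
    · refine Finset.sum_congr rfl fun j hj => ?_
      have hij : i ≠ j := by simpa [eq_comm] using hj
      simp only [if_neg hij]
    · intro j _ hj
      have hij : j = i := by simpa using hj
      simp [hij]

theorem cochainOfVector_mem_range {T : Fin n → Module.End K M} {v : Fin n → M}
    {β : Fin n → Fin n → M} (hβ : ∀ i j, β i j = -β j i) (hβ0 : ∀ i, β i i = 0)
    (hv : ∀ i, v i = ∑ j, T j (β i j)) :
    cochainOfVector K M n v ∈ LinearMap.range (koszulD T) := by
  -- Each unordered pair is counted once, through its increasing ordering.
  let b : Finset (Fin n) → M := fun S =>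
    ∑ i, ∑ j, if i < j ∧ S = {i, j}ᶜ then skewSign i j • β i j else 0
  have hb_lt : ∀ i j, i < j → b {i, j}ᶜ = skewSign i j • β i j := by
    intro i j hij
    simp only [b]
    have key : ∀ i' j' : Fin n, (i' < j' ∧ ({i, j}ᶜ : Finset (Fin n)) = {i', j'}ᶜ) ↔
        (i' = i ∧ j' = j) := by
      intro i' j'
      rw [compl_inj_iff]
      constructor
      · rintro ⟨h1, h2⟩
        have hi : i' ∈ ({i, j} : Finset (Fin n)) := by rw [h2]; simp
        have hj : j' ∈ ({i, j} : Finset (Fin n)) := by rw [h2]; simp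
        simp only [Finset.mem_insert, Finset.mem_singleton] at hi hj
        rcases hi with rfl | rfl <;> rcases hj with rfl | rfl
        · exact absurd h1 (lt_irrefl _)
        · exact ⟨rfl, rfl⟩
        · exact absurd h1 hij.not_gt
        · exact absurd h1 (lt_irrefl _)
      · rintro ⟨rfl, rfl⟩
        exact ⟨hij, rfl⟩
    simp only [key]
    rw [Finset.sum_eq_single i, Finset.sum_eq_single j]
    · simp
    · intro k _ hk; simp [hk]
    · simp
    · intro k _ hk; simp [hk]
    · simp
  have hb : ∀ i j, i ≠ j → b {i, j}ᶜ = skewSign i j • β i j := by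
    intro i j hij
    rcases lt_or_gt_of_ne hij with h | h
    · exact hb_lt i j h
    · rw [Finset.pair_comm, hb_lt j i h, skewSign_swap hij, hβ j i]
      simp
  have hb0 : ∀ S, (∀ i j, i < j → S ≠ {i, j}ᶜ) → b S = 0 := by
    intro S hS
    refine Finset.sum_eq_zero fun i _ => Finset.sum_eq_zero fun j _ => if_neg ?_
    rintro ⟨h1, h2⟩
    exact hS i j h1 h2
  refine ⟨b, funext fun S => ?_⟩
  by_cases hS : ∃ i, S = {i}ᶜ
  · obtain ⟨i, rfl⟩ := hS
    rw [koszulD_apply_compl, cochainOfVector_compl, hv]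
    congr 1
    rw [← Finset.sum_subset (Finset.subset_univ ({i}ᶜ : Finset (Fin n)))]
    · refine Finset.sum_congr rfl fun j hj => ?_
      have hij : i ≠ j := by simpa [eq_comm] using hj
      rw [hb i j hij, smul_smul, skewSign_mul_self, one_smul]
    · intro j _ hj
      have hij : j = i := by simpa using hj
      simp [hij, hβ0]
  · push Not at hS
    rw [cochainOfVector_of_ne v hS]
    simp only [koszulD, LinearMap.pi_apply, LinearMap.sum_apply, LinearMap.smul_apply,
      LinearMap.comp_apply, LinearMap.proj_apply]
    refine Finset.sum_eq_zero fun j hj => ?_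
    rw [hb0 (S.erase j), map_zero, smul_zero]
    intro i k hik h
    have hj' : j ∈ ({i, k} : Finset (Fin n)) := by
      by_contra hne
      have : j ∈ S.erase j := by rw [h]; exact Finset.mem_compl.2 hne
      simp at this
    rw [← Finset.insert_erase hj, h] at hS
    simp only [Finset.mem_insert, Finset.mem_singleton] at hj'
    rcases hj' with rfl | rfl
    · refine hS k ?_
      ext l
      by_cases hl : l = j
      · simp [hl, hik.ne]
      · simp [hl]
    · refine hS i ?_
      ext l
      by_cases hl : l = j
      · simp [hl, hik.ne']
      · simp [hl]

/-- Swapping the two summation indices turns the double sum into its negative, and `2` is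
invertible. -/
theorem operatorDiv_skew [CharZero K] {T : Fin n → Module.End K M}
    (hT : ∀ i j x, T i (T j x) = T j (T i x)) {β : Fin n → Fin n → M}
    (hβ : ∀ i j, β i j = -β j i) : operatorDiv T (fun i => ∑ j, T j (β i j)) = 0 := by
  have h : operatorDiv T (fun i => ∑ j, T j (β i j)) =
      -operatorDiv T (fun i => ∑ j, T j (β i j)) := by
    conv_lhs => rw [operatorDiv_apply]
    rw [operatorDiv_apply, ← Finset.sum_neg_distrib]
    simp only [map_sum, ← Finset.sum_neg_distrib]
    rw [Finset.sum_comm]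
    refine Finset.sum_congr rfl fun i _ => Finset.sum_congr rfl fun j _ => ?_
    rw [hT, hβ, map_neg, map_neg]
  have h2 : (2 : K) • operatorDiv T (fun i => ∑ j, T j (β i j)) = 0 := by
    rw [two_smul]
    nth_rewrite 1 [h]
    simp
  exact (smul_eq_zero.1 h2).resolve_left two_ne_zero

end KoszulCodimensionOne

/-- If `Φ` and `Ψ` are linear maps with the same source and `Φ` maps the kernel of `Ψ` into `G`,
then `range Φ / G` embeds into any submodule containing the range of `Ψ`. -/
theorem LinearMap.exists_injective_quotient_range {K Z X Y : Type*} [Field K]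
    [AddCommGroup Z] [Module K Z] [AddCommGroup X] [Module K X] [AddCommGroup Y] [Module K Y]
    (Φ : Z →ₗ[K] X) (Ψ : Z →ₗ[K] Y) {Y' : Submodule K Y} (hY : ∀ z, Ψ z ∈ Y')
    {G : Submodule K X} (hG : ∀ z, Ψ z = 0 → Φ z ∈ G) :
    ∃ η : (LinearMap.range Φ ⧸ G.submoduleOf (LinearMap.range Φ)) →ₗ[K] Y',
      Function.Injective η := by
  let q := (G.submoduleOf (LinearMap.range Φ)).mkQ ∘ₗ Φ.rangeRestrict
  have hq : LinearMap.range q = ⊤ := LinearMap.range_eq_top.2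
    ((Submodule.mkQ_surjective _).comp Φ.surjective_rangeRestrict)
  -- A linear section replaces well-definedness: `Ψ` need not descend to the quotient.
  obtain ⟨s, hs⟩ := q.exists_rightInverse_of_surjective hq
  refine ⟨(Ψ.codRestrict Y' hY) ∘ₗ s, (injective_iff_map_eq_zero _).2 fun x hx => ?_⟩
  have h0 : Ψ (s x) = 0 := congr_arg Subtype.val hx
  have h1 : q (s x) = x := LinearMap.congr_fun hs x
  rw [← h1]
  exact (Submodule.Quotient.mk_eq_zero _).2 (hG _ h0)

end

noncomputable section

/-! ### Fractions with denominator a power of `f`, modulo polynomials -/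

section PolarParts

variable {K R : Type*} [Field K] [CommRing R] [Algebra K R]

open IsLocalization.Away (invSelf)

theorem derivAway_invSelf_pow (D : Derivation K R R) (f : R) (ν : ℕ) :
    derivAway D f (invSelf f ^ ν) =
      -((ν : Localization.Away f) * algebraMap R _ (D f) * invSelf f ^ (ν + 1)) := by
  have hu : algebraMap R (Localization.Away f) f * invSelf f = 1 :=
    IsLocalization.Away.mul_invSelf f
  have h1 : derivAway D f (invSelf f) = -(algebraMap R _ (D f) * invSelf f ^ 2) := by
    have h := congr_arg (derivAway D f) hu
    rw [Derivation.leibniz, derivAway_algebraMap, Derivation.map_one_eq_zero, smul_eq_mul,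
      smul_eq_mul] at h
    linear_combination invSelf f * h - derivAway D f (invSelf f) * hu
  induction ν with
  | zero => simp
  | succ ν ih =>
    rw [pow_succ, Derivation.leibniz, ih, h1, smul_eq_mul, smul_eq_mul]
    push_cast
    ring

/-- The class of the fraction `a / f ^ ν` in the first local cohomology. -/
def polarPart (K : Type*) {R : Type*} [Field K] [CommRing R] [Algebra K R] (f : R) (ν : ℕ) :
    R →ₗ[K] LocalCohomologyOne K f :=
  Submodule.mkQ _ ∘ₗ LinearMap.mulRight K (invSelf f ^ ν) ∘ₗ (toAway K f).toLinearMap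

theorem polarPart_apply (f : R) (ν : ℕ) (a : R) :
    polarPart K f ν a = Submodule.Quotient.mk (algebraMap R _ a * invSelf f ^ ν) := rfl

theorem polarPart_zero (f a : R) : polarPart K f 0 a = 0 := by
  rw [polarPart_apply, Submodule.Quotient.mk_eq_zero]
  exact ⟨a, by simp [toAway]⟩

theorem polarPart_add_mul_pow (f a : R) (ν k : ℕ) :
    polarPart K f (ν + k) (f ^ k * a) = polarPart K f ν a := by
  rw [polarPart_apply, polarPart_apply]
  congr 1
  have hu : algebraMap R (Localization.Away f) f ^ k * invSelf f ^ k = 1 := by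
    rw [← mul_pow, IsLocalization.Away.mul_invSelf f, one_pow]
  rw [map_mul, map_pow, pow_add]
  linear_combination (algebraMap R (Localization.Away f) a * invSelf f ^ ν) * hu

theorem polarPart_succ_mul (f a : R) (ν : ℕ) :
    polarPart K f (ν + 1) (f * a) = polarPart K f ν a := by
  simpa using polarPart_add_mul_pow (K := K) f a ν 1

/-- The quotient rule over the common denominator `f ^ (ν + 1)`. Modulo `f` only the second term of
the numerator survives. -/
theorem derivLocalCohomologyOne_polarPart (D : Derivation K R R) (f a : R) (ν : ℕ) :
    derivLocalCohomologyOne D f (polarPart K f ν a) =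
      polarPart K f (ν + 1) (f * D a - ν * (a * D f)) := by
  rw [polarPart_apply, polarPart_apply]
  refine congr_arg Submodule.Quotient.mk (?_ : derivAway D f _ = _)
  have hu : algebraMap R (Localization.Away f) f * invSelf f = 1 :=
    IsLocalization.Away.mul_invSelf f
  rw [Derivation.leibniz, derivAway_invSelf_pow, derivAway_algebraMap]
  simp only [smul_eq_mul, map_sub, map_mul, map_natCast, pow_succ]
  linear_combination (-(invSelf f ^ ν * algebraMap R _ (D a))) * hu

theorem polarPart_eq_zero_iff [IsDomain R] {f : R} (hf : f ≠ 0) (ν : ℕ) (a : R) :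
    polarPart K f ν a = 0 ↔ f ^ ν ∣ a := by
  have hu : algebraMap R (Localization.Away f) f ^ ν * invSelf f ^ ν = 1 := by
    rw [← mul_pow, IsLocalization.Away.mul_invSelf f, one_pow]
  rw [polarPart_apply, Submodule.Quotient.mk_eq_zero]
  have hinj : Function.Injective (algebraMap R (Localization.Away f)) :=
    IsLocalization.injective _ (powers_le_nonZeroDivisors_of_noZeroDivisors hf)
  constructor
  · rintro ⟨r, hr⟩
    replace hr : algebraMap R (Localization.Away f) r = algebraMap R _ a * invSelf f ^ ν := hr
    refine ⟨r, hinj ?_⟩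
    rw [map_mul, map_pow, hr]
    linear_combination (-algebraMap R (Localization.Away f) a) * hu
  · rintro ⟨r, rfl⟩
    refine ⟨r, ?_⟩
    change algebraMap R (Localization.Away f) r = _
    rw [map_mul, map_pow]
    linear_combination (-algebraMap R (Localization.Away f) r) * hu

theorem exists_polarPart_eq (f : R) (x : LocalCohomologyOne K f) :
    ∃ ν a, x = polarPart K f ν a := by
  obtain ⟨y, rfl⟩ := Submodule.Quotient.mk_surjective _ x
  obtain ⟨ν, a, h⟩ := IsLocalization.Away.surj f y
  refine ⟨ν, a, ?_⟩
  have hu : algebraMap R (Localization.Away f) f ^ ν * invSelf f ^ ν = 1 := by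
    rw [← mul_pow, IsLocalization.Away.mul_invSelf f, one_pow]
  rw [polarPart_apply, ← h]
  congr 1
  linear_combination (-y) * hu

theorem exists_forall_polarPart_eq {ι : Type*} [Fintype ι] (f : R)
    (x : ι → LocalCohomologyOne K f) : ∃ ν, ∃ a : ι → R, ∀ i, x i = polarPart K f ν (a i) := by
  choose k b hb using fun i => exists_polarPart_eq f (x i)
  refine ⟨∑ i, k i, fun i => f ^ (∑ j, k j - k i) * b i, fun i => ?_⟩
  have hle : k i ≤ ∑ j, k j := Finset.single_le_sum (fun _ _ => Nat.zero_le _) (Finset.mem_univ i)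
  obtain ⟨m, hm⟩ := Nat.exists_eq_add_of_le hle
  simp only [hm, Nat.add_sub_cancel_left]
  rw [polarPart_add_mul_pow, hb]

theorem derivLocalCohomologyOne_comm {D E : Derivation K R R} (h : ∀ a, D (E a) = E (D a)) (f : R)
    (x : LocalCohomologyOne K f) :
    derivLocalCohomologyOne D f (derivLocalCohomologyOne E f x) =
      derivLocalCohomologyOne E f (derivLocalCohomologyOne D f x) := by
  obtain ⟨ν, a, rfl⟩ := exists_polarPart_eq f x
  simp only [derivLocalCohomologyOne_polarPart]
  congr 1
  simp only [map_sub, Derivation.leibniz, smul_eq_mul, h, Derivation.map_natCast, Nat.cast_add]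
  ring

/-- For `f = 0` the localization is zero; for a unit it adds nothing to `R`. -/
theorem subsingleton_localCohomologyOne {f : R} (hf : f = 0 ∨ IsUnit f) :
    Subsingleton (LocalCohomologyOne K f) := by
  refine ⟨fun x y => ?_⟩
  have key : ∀ x : LocalCohomologyOne K f, x = 0 := by
    intro x
    obtain ⟨ν, a, rfl⟩ := exists_polarPart_eq f x
    rcases hf with rfl | hf
    · rw [← polarPart_succ_mul]
      simp
    · obtain ⟨b, rfl⟩ := (hf.pow ν).dvd (a := a)
      have := polarPart_add_mul_pow (K := K) f b 0 ν
      rw [zero_add] at this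
      rw [this, polarPart_zero]
  rw [key x, key y]

end PolarParts

/-! ### Weighted homogeneous components and Euler's identity -/

namespace MvPolynomial

variable {K σ : Type*} [Field K]

theorem weightedHomogeneousComponent_mul_left {M : Type*} [AddCancelCommMonoid M] {w : σ → M}
    {f : MvPolynomial σ K} {d : M} (hf : IsWeightedHomogeneous w f d) (e : M)
    (g : MvPolynomial σ K) :
    weightedHomogeneousComponent w (d + e) (f * g) = f * weightedHomogeneousComponent w e g := by
  classical
  induction g using MvPolynomial.induction_on' with
  | monomial m c =>
    have hm : IsWeightedHomogeneous w (monomial m c) (Finsupp.weight w m) :=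
      isWeightedHomogeneous_monomial w m c rfl
    by_cases h : Finsupp.weight w m = e
    · rw [← h, hm.weightedHomogeneousComponent_same, (hf.mul hm).weightedHomogeneousComponent_same]
    · rw [hm.weightedHomogeneousComponent_ne _ (Ne.symm h), mul_zero,
        (hf.mul hm).weightedHomogeneousComponent_ne]
      exact fun h' => h (add_left_cancel h').symm
  | add p q hp hq => rw [mul_add, map_add, map_add, hp, hq, mul_add]

theorem weightedHomogeneousComponent_pderiv {M : Type*} [AddCancelCommMonoid M] (w : σ → M)
    (e : M) (i : σ) (g : MvPolynomial σ K) :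
    weightedHomogeneousComponent w e (pderiv i g) =
      pderiv i (weightedHomogeneousComponent w (e + w i) g) := by
  classical
  ext m
  simp only [coeff_weightedHomogeneousComponent, coeff_pderiv, map_add, Finsupp.weight_single,
    one_smul, add_left_inj]
  split_ifs <;> simp

/-- Degrees lie in a group so that `d - w i` makes sense even when it is negative; this is why the
weights are later cast to `ℤ`. -/
theorem weightedHomogeneousComponent_mul_pderiv {M : Type*} [AddCommGroup M] {w : σ → M}
    {f : MvPolynomial σ K} {d : M} (hf : IsWeightedHomogeneous w f d) (e : M) (i : σ)
    (g : MvPolynomial σ K) :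
    weightedHomogeneousComponent w e (g * pderiv i f) =
      weightedHomogeneousComponent w (e - d + w i) g * pderiv i f := by
  have h : IsWeightedHomogeneous w (pderiv i f) (d - w i) := hf.pderiv (sub_add_cancel _ _)
  rw [mul_comm, mul_comm _ (pderiv i f), ← weightedHomogeneousComponent_mul_left h]
  congr 2
  abel

theorem IsWeightedHomogeneous.eq_zero_of_neg {w : σ → ℕ} {g : MvPolynomial σ K} {e : ℤ}
    (hg : IsWeightedHomogeneous (fun i => (w i : ℤ)) g e) (he : e < 0) : g = 0 := by
  ext m
  by_contra h
  have h1 := hg h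
  have h2 : 0 ≤ Finsupp.weight (fun i => (w i : ℤ)) m := by
    rw [Finsupp.weight_apply]
    exact Finset.sum_nonneg fun i _ => by positivity
  omega

theorem IsWeightedHomogeneous.natCast_weights {w : σ → ℕ} {g : MvPolynomial σ K} {d : ℕ}
    (hg : IsWeightedHomogeneous w g d) : IsWeightedHomogeneous (fun i => (w i : ℤ)) g d := by
  intro m hm
  have h := hg hm
  rw [Finsupp.weight_apply] at h ⊢
  rw [← h]
  simp [Finsupp.sum]

/-- Euler's identity, checked on monomials, where `X i * ∂ᵢ` multiplies by the exponent of `X i`. -/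
theorem IsWeightedHomogeneous.sum_int_weight_mul_X_mul_pderiv [Fintype σ] {w : σ → ℤ}
    {g : MvPolynomial σ K} {e : ℤ} (hg : IsWeightedHomogeneous w g e) :
    ∑ i, (w i : MvPolynomial σ K) * X i * pderiv i g = (e : MvPolynomial σ K) * g := by
  classical
  have key : ∀ m : σ →₀ ℕ, ∀ c : K, ∑ i, (w i : MvPolynomial σ K) * X i * pderiv i (monomial m c) =
      ((Finsupp.weight w m : ℤ) : MvPolynomial σ K) * monomial m c := by
    intro m c
    simp_rw [mul_assoc, X_mul_pderiv_monomial, Finsupp.weight_apply]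
    rw [Finsupp.sum_fintype _ _ (by simp), Int.cast_sum, Finset.sum_mul]
    refine Finset.sum_congr rfl fun i _ => ?_
    simp only [nsmul_eq_mul]
    push_cast
    ring
  rw [g.as_sum]
  simp only [map_sum, Finset.mul_sum]
  rw [Finset.sum_comm]
  refine Finset.sum_congr rfl fun m hm => ?_
  rw [key, hg (mem_support_iff.1 hm)]

/-- The weight of a monomial is at most `W` times its ordinary degree. -/
theorem IsWeightedHomogeneous.mem_pow_idealOfVars [Fintype σ] {w : σ → ℕ} {W s : ℕ}
    (hW : ∀ i, w i ≤ W) {g : MvPolynomial σ K} {e : ℤ}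
    (hg : IsWeightedHomogeneous (fun i => (w i : ℤ)) g e) (he : (s : ℤ) * W < e) :
    g ∈ idealOfVars σ K ^ s := by
  rw [mem_pow_idealOfVars_iff]
  intro m hm
  have h := hg (mem_support_iff.1 hm)
  rw [Finsupp.weight_apply, Finsupp.sum_fintype _ _ (by simp)] at h
  by_contra! hlt
  have h2 : ∑ i, m i • (w i : ℤ) ≤ (m.degree : ℤ) * W := by
    rw [Finsupp.degree_eq_sum, Nat.cast_sum, Finset.sum_mul]
    refine Finset.sum_le_sum fun i _ => ?_
    rw [nsmul_eq_mul]
    exact mul_le_mul_of_nonneg_left (by exact_mod_cast hW i) (by positivity)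
  have h3 : (m.degree : ℤ) * W ≤ (s : ℤ) * W :=
    mul_le_mul_of_nonneg_right (by exact_mod_cast hlt.le) (by positivity)
  omega

theorem sum_weightedHomogeneousComponent_of_subset {M : Type*} [AddCommMonoid M] [DecidableEq M]
    (w : σ → M) (g : MvPolynomial σ K) {E : Finset M}
    (hE : g.support.image (Finsupp.weight w) ⊆ E) :
    ∑ e ∈ E, weightedHomogeneousComponent w e g = g := by
  ext m
  simp only [coeff_sum, coeff_weightedHomogeneousComponent, Finset.sum_ite_eq]
  split_ifs with h
  · rfl
  · by_contra hm
    exact h (hE (Finset.mem_image_of_mem _ (mem_support_iff.2 (Ne.symm hm))))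

end MvPolynomial

end

noncomputable section

/-! ### The filtration by pole order and reduction to degree zero -/

section PoleOrder

variable {K : Type*} [Field K] {n : ℕ}

/-- The vectors `(aᵢ)` such that the `(n - 1)`-form with coefficients `aᵢ / f ^ ν` is homogeneous of
degree zero, where `f` has degree `d`. -/
def poleNumerators (K : Type*) [Field K] {n : ℕ} (w : Fin n → ℕ) (d ν : ℕ) :
    Submodule K (Fin n → MvPolynomial (Fin n) K) :=
  Submodule.pi Set.univ fun i =>
    weightedHomogeneousSubmodule K (fun i => (w i : ℤ)) ((ν : ℤ) * d - ∑ j, (w j : ℤ) + w i)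

theorem mem_poleNumerators {w : Fin n → ℕ} {d ν : ℕ} {a : Fin n → MvPolynomial (Fin n) K} :
    a ∈ poleNumerators K w d ν ↔ ∀ i, IsWeightedHomogeneous (fun i => (w i : ℤ)) (a i)
      ((ν : ℤ) * d - ∑ j, (w j : ℤ) + w i) := by
  simp [poleNumerators, Submodule.mem_pi, mem_weightedHomogeneousSubmodule]

/-- The vector with entries `aᵢ / f ^ ν` in local cohomology. -/
def polarVector (f : MvPolynomial (Fin n) K) (ν : ℕ) :
    (Fin n → MvPolynomial (Fin n) K) →ₗ[K] (Fin n → LocalCohomologyOne K f) :=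
  (polarPart K f ν).compLeft (Fin n)

theorem polarVector_apply (f : MvPolynomial (Fin n) K) (ν : ℕ) (a : Fin n → MvPolynomial (Fin n) K)
    (i : Fin n) : polarVector f ν a i = polarPart K f ν (a i) := rfl

/-- The numerator of the divergence of the vector with entries `aᵢ / f ^ ν`. -/
def divNumerator (f : MvPolynomial (Fin n) K) (ν : ℕ) (a : Fin n → MvPolynomial (Fin n) K) :
    MvPolynomial (Fin n) K :=
  ∑ i, (f * pderiv i (a i) - ν * (a i * pderiv i f))

theorem sum_deRhamOperators_polarPart (f : MvPolynomial (Fin n) K) (ν : ℕ)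
    (a : Fin n → MvPolynomial (Fin n) K) :
    ∑ i, deRhamOperators f i (polarPart K f ν (a i)) =
      polarPart K f (ν + 1) (divNumerator f ν a) := by
  rw [divNumerator, map_sum]
  exact Finset.sum_congr rfl fun i _ => derivLocalCohomologyOne_polarPart _ _ _ _

theorem operatorDiv_polarVector_eq_zero_iff {f : MvPolynomial (Fin n) K} (hf : f ≠ 0) (ν : ℕ)
    (a : Fin n → MvPolynomial (Fin n) K) :
    operatorDiv (deRhamOperators f) (polarVector f ν a) = 0 ↔
      f ^ (ν + 1) ∣ divNumerator f ν a := by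
  rw [← polarPart_eq_zero_iff (K := K) hf, ← sum_deRhamOperators_polarPart, operatorDiv_apply]
  rfl

theorem divNumerator_eq (f : MvPolynomial (Fin n) K) (ν : ℕ)
    (a : Fin n → MvPolynomial (Fin n) K) :
    divNumerator f ν a = f * ∑ i, pderiv i (a i) - ν * ∑ i, a i * pderiv i f := by
  rw [divNumerator, Finset.sum_sub_distrib, Finset.mul_sum, Finset.mul_sum]

/-- The vectors of homogeneous numerators whose form with pole of order `ν` is closed. -/
def poleCocycles (w : Fin n → ℕ) (d : ℕ) (f : MvPolynomial (Fin n) K) (ν : ℕ) :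
    Submodule K (Fin n → MvPolynomial (Fin n) K) :=
  poleNumerators K w d ν ⊓ LinearMap.ker (operatorDiv (deRhamOperators f) ∘ₗ polarVector f ν)

theorem mem_poleCocycles {w : Fin n → ℕ} {d ν : ℕ} {f : MvPolynomial (Fin n) K}
    {a : Fin n → MvPolynomial (Fin n) K} :
    a ∈ poleCocycles w d f ν ↔ a ∈ poleNumerators K w d ν ∧
      operatorDiv (deRhamOperators f) (polarVector f ν a) = 0 := Iff.rfl

/-- The de Rham class of a closed form with a pole of order `ν`. -/
def poleClass (w : Fin n → ℕ) (d : ℕ) (f : MvPolynomial (Fin n) K) (ν : ℕ) :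
    poleCocycles w d f ν →ₗ[K] KoszulCohomology (deRhamOperators f) (n - 1) :=
  koszulClass (deRhamOperators f) ∘ₗ (polarVector f ν).restrict fun _ ha => ha.2

theorem poleClass_eq_of_sub_mem_range {w : Fin n → ℕ} {d ν : ℕ} {f : MvPolynomial (Fin n) K}
    (a : poleCocycles w d f ν) (v : LinearMap.ker (operatorDiv (deRhamOperators f)))
    (h : cochainOfVector K _ n ((v : Fin n → LocalCohomologyOne K f) - polarVector f ν a) ∈
      LinearMap.range (koszulD (deRhamOperators f))) :
    poleClass w d f ν a = koszulClass (deRhamOperators f) v := by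
  rw [eq_comm, ← sub_eq_zero, poleClass, LinearMap.comp_apply, ← map_sub, koszulClass_eq_zero_iff]
  exact h

theorem poleClass_zero (w : Fin n → ℕ) (d : ℕ) (f : MvPolynomial (Fin n) K) :
    poleClass w d f 0 = 0 := by
  ext a
  refine (poleClass_eq_of_sub_mem_range a 0 ?_).trans (map_zero _)
  have : polarVector f 0 (a : Fin n → MvPolynomial (Fin n) K) = 0 :=
    funext fun i => polarPart_zero f _
  simp [this]

theorem range_poleClass_le_succ {w : Fin n → ℕ} {d : ℕ} {f : MvPolynomial (Fin n) K}
    (hf : IsWeightedHomogeneous (fun i => (w i : ℤ)) f (d : ℤ)) (ν : ℕ) :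
    LinearMap.range (poleClass w d f ν) ≤ LinearMap.range (poleClass w d f (ν + 1)) := by
  rintro _ ⟨⟨a, ha⟩, rfl⟩
  have hv : polarVector f (ν + 1) (fun i => f * a i) = polarVector f ν a :=
    funext fun i => polarPart_succ_mul f (a i) ν
  refine ⟨⟨fun i => f * a i, mem_poleCocycles.2 ⟨mem_poleNumerators.2 fun i => ?_, ?_⟩⟩, ?_⟩
  · convert hf.mul (mem_poleNumerators.1 ha.1 i) using 1
    push_cast
    ring
  · rw [hv]; exact ha.2
  · refine poleClass_eq_of_sub_mem_range _ ⟨polarVector f ν a, ha.2⟩ ?_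
    simp [hv]

/-- Cartan's homotopy formula: a closed form with poles along `f`, homogeneous of degree `e ≠ 0`,
is exact. -/
theorem cochainOfVector_polarVector_mem_range [CharZero K] {w : Fin n → ℕ} {d ν : ℕ}
    {f : MvPolynomial (Fin n) K} (hf0 : f ≠ 0)
    (hf : IsWeightedHomogeneous (fun i => (w i : ℤ)) f (d : ℤ)) {e : ℤ} (he : e ≠ 0)
    {a : Fin n → MvPolynomial (Fin n) K}
    (ha : ∀ i, IsWeightedHomogeneous (fun i => (w i : ℤ)) (a i)
      ((ν : ℤ) * d - ∑ j, (w j : ℤ) + w i + e))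
    (hdiv : operatorDiv (deRhamOperators f) (polarVector f ν a) = 0) :
    cochainOfVector K _ n (polarVector f ν a) ∈ LinearMap.range (koszulD (deRhamOperators f)) := by
  have hdvd := (operatorDiv_polarVector_eq_zero_iff hf0 ν a).1 hdiv
  rw [divNumerator_eq] at hdvd
  obtain ⟨q, hq⟩ := hdvd
  have heK : (e : K) ≠ 0 := by exact_mod_cast he
  -- The coefficients of the Euler vector field.
  let u : Fin n → MvPolynomial (Fin n) K := fun k => ((w k : ℤ) : MvPolynomial (Fin n) K) * X k
  have hu : ∀ i k, pderiv i (u k) = if i = k then ((w k : ℤ) : MvPolynomial (Fin n) K) else 0 := by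
    intro i k
    simp only [u, Derivation.leibniz, Derivation.map_intCast, smul_eq_mul, mul_zero, add_zero,
      pderiv_X, Pi.single_apply]
    by_cases h : i = k <;> simp [h, eq_comm]
  -- The multiples of `a i` collected are `ω` from `∂ⱼ (u j)`, `-w i` from `∂ᵢ (u i)`, the degree of
  -- `a i` by Euler, and `-ν * d` from the denominator; they add up to `e`. The remaining terms form
  -- `-u i` times the divergence numerator, which `f ^ (ν + 1)` divides, so they vanish in local
  -- cohomology.
  have hT : ∀ i, ∑ j, deRhamOperators f j (polarPart K f ν (u j * a i - u i * a j)) =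
      (e : K) • polarPart K f ν (a i) := by
    intro i
    have h1 := (ha i).sum_int_weight_mul_X_mul_pderiv
    have h2 := hf.sum_int_weight_mul_X_mul_pderiv
    have h3 : ∑ j, pderiv j (u j * a i - u i * a j) =
        (∑ j, ((w j : ℤ) : MvPolynomial (Fin n) K)) * a i + ∑ j, u j * pderiv j (a i) -
          ((w i : ℤ) : MvPolynomial (Fin n) K) * a i - u i * ∑ j, pderiv j (a j) := by
      simp only [map_sub, Derivation.leibniz, smul_eq_mul, hu, if_true, Finset.sum_sub_distrib,
        Finset.sum_add_distrib, Finset.sum_mul, Finset.mul_sum,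
        mul_comm (a _)]
      simp only [ite_mul, zero_mul, Finset.sum_ite_eq', Finset.mem_univ, if_true]
      ring
    have h4 : ∑ j, (u j * a i - u i * a j) * pderiv j f =
        a i * ∑ j, u j * pderiv j f - u i * ∑ j, a j * pderiv j f := by
      rw [Finset.mul_sum, Finset.mul_sum, ← Finset.sum_sub_distrib]
      exact Finset.sum_congr rfl fun j _ => by ring
    have h5 : divNumerator f ν (fun j => u j * a i - u i * a j) =
        f * ((e : K) • a i) + f ^ (ν + 1) * (-(u i * q)) := by
      rw [divNumerator_eq, h3, h4, h1, h2, Int.cast_smul_eq_zsmul K e (a i),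
        zsmul_eq_mul]
      push_cast
      linear_combination (-u i) * hq
    rw [sum_deRhamOperators_polarPart, h5, map_add, polarPart_succ_mul, map_smul,
      (polarPart_eq_zero_iff hf0 _ _).2 (Dvd.intro _ rfl), add_zero]
  refine cochainOfVector_mem_range
    (β := fun i j => (e : K)⁻¹ • polarPart K f ν (u j * a i - u i * a j)) ?_ (by simp) ?_
  · intro i j
    rw [← smul_neg, ← map_neg, neg_sub]
  · intro i
    simp only [map_smul]
    rw [← Finset.smul_sum, hT, smul_smul, inv_mul_cancel₀ heK, one_smul]
    rfl

theorem divNumerator_weightedHomogeneousComponent {w : Fin n → ℕ} {d : ℕ}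
    {f : MvPolynomial (Fin n) K} (hf : IsWeightedHomogeneous (fun i => (w i : ℤ)) f (d : ℤ))
    (ν : ℕ) (a : Fin n → MvPolynomial (Fin n) K) (e : ℤ) :
    divNumerator f ν (fun i => weightedHomogeneousComponent (fun i => (w i : ℤ)) (e + w i) (a i)) =
      weightedHomogeneousComponent (fun i => (w i : ℤ)) (d + e) (divNumerator f ν a) := by
  rw [divNumerator, divNumerator, map_sum]
  refine Finset.sum_congr rfl fun i _ => ?_
  rw [map_sub, weightedHomogeneousComponent_mul_left hf, weightedHomogeneousComponent_pderiv,
    ← nsmul_eq_mul, ← nsmul_eq_mul, map_nsmul, weightedHomogeneousComponent_mul_pderiv hf]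
  simp only [add_sub_cancel_left]

/-- Closedness is divisibility of the numerator by the homogeneous polynomial `f ^ (ν + 1)`, which
passes to components. -/
theorem operatorDiv_polarVector_weightedHomogeneousComponent {w : Fin n → ℕ} {d ν : ℕ}
    {f : MvPolynomial (Fin n) K} (hf0 : f ≠ 0)
    (hf : IsWeightedHomogeneous (fun i => (w i : ℤ)) f (d : ℤ))
    {a : Fin n → MvPolynomial (Fin n) K}
    (hdiv : operatorDiv (deRhamOperators f) (polarVector f ν a) = 0) (e : ℤ) :
    operatorDiv (deRhamOperators f) (polarVector f ν
      fun i => weightedHomogeneousComponent (fun i => (w i : ℤ)) (e + w i) (a i)) = 0 := by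
  rw [operatorDiv_polarVector_eq_zero_iff hf0] at hdiv ⊢
  obtain ⟨q, hq⟩ := hdiv
  rw [divNumerator_weightedHomogeneousComponent hf, hq,
    show (d : ℤ) + e = (ν + 1) • (d : ℤ) + (d + e - (ν + 1) • (d : ℤ)) by ring,
    weightedHomogeneousComponent_mul_left (hf.pow (ν + 1))]
  exact Dvd.intro _ rfl

/-- Every de Rham class in degree `n - 1` is represented by a homogeneous form of degree zero. -/
theorem exists_mem_range_poleClass [CharZero K] (hn : 1 ≤ n) {w : Fin n → ℕ} {d : ℕ}
    {f : MvPolynomial (Fin n) K} (hf0 : f ≠ 0)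
    (hf : IsWeightedHomogeneous (fun i => (w i : ℤ)) f (d : ℤ))
    (x : KoszulCohomology (deRhamOperators f) (n - 1)) :
    ∃ ν, x ∈ LinearMap.range (poleClass w d f ν) := by
  classical
  obtain ⟨⟨v, hv⟩, rfl⟩ := koszulClass_surjective hn _ x
  obtain ⟨ν, a, ha⟩ := exists_forall_polarPart_eq f v
  obtain rfl : v = polarVector f ν a := funext ha
  let D : ℤ := (ν : ℤ) * d - ∑ j, (w j : ℤ)
  let c : ℤ → Fin n → MvPolynomial (Fin n) K := fun e i =>
    weightedHomogeneousComponent (fun i => (w i : ℤ)) (D + e + w i) (a i)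
  have hc : ∀ e i, IsWeightedHomogeneous (fun i => (w i : ℤ)) (c e i) (D + w i + e) := by
    intro e i
    rw [add_right_comm D]
    exact weightedHomogeneousComponent_mem (fun i => (w i : ℤ)) (a i) _
  have hcdiv : ∀ e, operatorDiv (deRhamOperators f) (polarVector f ν (c e)) = 0 := fun e =>
    operatorDiv_polarVector_weightedHomogeneousComponent hf0 hf hv (D + e)
  -- All degrees that occur, relative to that of a degree-zero form; `0` is inserted so that its
  -- component can always be split off. The others are exact.
  let E : Finset ℤ := insert 0 (Finset.univ.biUnion fun i =>
    (a i).support.image fun m => Finsupp.weight (fun i => (w i : ℤ)) m - (D + w i))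
  have hsum : a = ∑ e ∈ E, c e := by
    funext i
    rw [Finset.sum_apply]
    have := MvPolynomial.sum_weightedHomogeneousComponent_of_subset (fun i => (w i : ℤ)) (a i)
      (E := E.image fun e => D + e + (w i : ℤ)) (by
        intro k hk
        obtain ⟨m, hm, rfl⟩ := Finset.mem_image.1 hk
        refine Finset.mem_image.2 ⟨_, Finset.mem_insert_of_mem (Finset.mem_biUnion.2
          ⟨i, Finset.mem_univ _, Finset.mem_image_of_mem _ hm⟩), ?_⟩
        ring)
    rw [Finset.sum_image (fun x _ y _ h => by simpa using h)] at this
    exact this.symm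
  refine ⟨ν, ⟨c 0, mem_poleCocycles.2 ⟨mem_poleNumerators.2 fun i => ?_, hcdiv 0⟩⟩, ?_⟩
  · simpa using hc 0 i
  · refine poleClass_eq_of_sub_mem_range _ ⟨polarVector f ν a, hv⟩ ?_
    have h1 : polarVector f ν a - polarVector f ν (c 0) =
        ∑ e ∈ E.erase 0, polarVector f ν (c e) := by
      rw [← map_sub, ← map_sum]
      congr 1
      nth_rewrite 1 [hsum]
      rw [← Finset.add_sum_erase E c (Finset.mem_insert_self 0 _), add_sub_cancel_left]
    change cochainOfVector K _ n (polarVector f ν a - polarVector f ν (c 0)) ∈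
      LinearMap.range (koszulD (deRhamOperators f))
    rw [h1, map_sum]
    exact Submodule.sum_mem _ fun e he => cochainOfVector_polarVector_mem_range hf0 hf
      (Finset.ne_of_mem_erase he) (hc e) (hcdiv e)

end PoleOrder

end

noncomputable section

/-! ### Koszul cycles and boundaries modulo `f` -/

section ResidueVector

variable {K : Type*} [Field K] {n : ℕ}

/-- The vector of residue classes of `aᵢ` in the hypersurface ring. -/
def residueVector (f : MvPolynomial (Fin n) K) :
    (Fin n → MvPolynomial (Fin n) K) →ₗ[K] (Fin n → HypersurfaceRing f) :=
  (Ideal.Quotient.mkₐ K (Ideal.span {f})).toLinearMap.compLeft (Fin n)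

theorem residueVector_apply (f : MvPolynomial (Fin n) K) (a : Fin n → MvPolynomial (Fin n) K)
    (i : Fin n) : residueVector f a i = Ideal.Quotient.mk (Ideal.span {f}) (a i) := rfl

theorem jacobianOperators_mk (f : MvPolynomial (Fin n) K) (i : Fin n)
    (a : MvPolynomial (Fin n) K) :
    jacobianOperators f i (Ideal.Quotient.mk (Ideal.span {f}) a) =
      Ideal.Quotient.mk (Ideal.span {f}) (a * pderiv i f) := by
  rw [mul_comm, map_mul]
  rfl

theorem operatorDiv_residueVector (f : MvPolynomial (Fin n) K)
    (a : Fin n → MvPolynomial (Fin n) K) :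
    operatorDiv (jacobianOperators f) (residueVector f a) =
      Ideal.Quotient.mk (Ideal.span {f}) (∑ i, a i * pderiv i f) := by
  rw [operatorDiv_apply, map_sum]
  exact Finset.sum_congr rfl fun i _ => jacobianOperators_mk f i (a i)

/-- The vectors that are Koszul boundaries of the partial derivatives modulo `f`. -/
def jacobianBoundaries (f : MvPolynomial (Fin n) K) :
    Submodule (MvPolynomial (Fin n) K) (Fin n → MvPolynomial (Fin n) K) where
  carrier := {a | ∃ (β : Fin n → Fin n → MvPolynomial (Fin n) K)
    (c : Fin n → MvPolynomial (Fin n) K), (∀ i j, β i j = -β j i) ∧ (∀ i, β i i = 0) ∧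
      ∀ i, a i = ∑ j, β i j * pderiv j f + f * c i}
  add_mem' := by
    rintro a b ⟨β, c, h1, h2, h3⟩ ⟨β', c', h1', h2', h3'⟩
    refine ⟨β + β', c + c', fun i j => ?_, fun i => ?_, fun i => ?_⟩
    · simp only [Pi.add_apply, h1 i j, h1' i j]; ring
    · simp [h2, h2']
    · simp only [Pi.add_apply, h3, h3', add_mul, Finset.sum_add_distrib]; ring
  zero_mem' := ⟨0, 0, by simp, by simp, by simp⟩
  smul_mem' := by
    rintro r a ⟨β, c, h1, h2, h3⟩
    refine ⟨r • β, r • c, fun i j => ?_, fun i => ?_, fun i => ?_⟩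
    · simp only [Pi.smul_apply, h1 i j, smul_neg]
    · simp [h2]
    · simp only [Pi.smul_apply, h3, smul_eq_mul, mul_add, Finset.mul_sum, mul_assoc]; ring

theorem cochainOfVector_residueVector_mem_range_iff {f : MvPolynomial (Fin n) K}
    {a : Fin n → MvPolynomial (Fin n) K} :
    cochainOfVector K _ n (residueVector f a) ∈ LinearMap.range (koszulD (jacobianOperators f)) ↔
      a ∈ jacobianBoundaries f := by
  constructor
  · intro h
    obtain ⟨β, h1, h2, h3⟩ := exists_skew_of_mem_range h
    choose g hg using fun i j => Ideal.Quotient.mk_surjective (β i j)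
    -- Lifts are kept only for `i < j` and extended by sign, so that `b` is skew in `R` itself and
    -- not merely modulo `f`.
    let b : Fin n → Fin n → MvPolynomial (Fin n) K := fun i j =>
      if i < j then g i j else if j < i then -g j i else 0
    have hb1 : ∀ i j, b i j = -b j i := by
      intro i j
      rcases lt_trichotomy i j with h | h | h
      · simp [b, h, h.not_gt]
      · simp [b, h]
      · simp [b, h, h.not_gt]
    have hb2 : ∀ i, b i i = 0 := by simp [b]
    have hb : ∀ i j, Ideal.Quotient.mk (Ideal.span {f}) (b i j) = β i j := by
      intro i j
      rcases lt_trichotomy i j with h | rfl | h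
      · simp [b, h, hg]
      · simp [b, h2]
      · simp [b, h, h.not_gt, hg, ← h1 i j]
    have hdvd : ∀ i, f ∣ a i - ∑ j, b i j * pderiv j f := by
      intro i
      rw [← Ideal.mem_span_singleton, ← Ideal.Quotient.eq_zero_iff_mem, map_sub, map_sum,
        ← residueVector_apply, h3, sub_eq_zero]
      refine Finset.sum_congr rfl fun j _ => ?_
      rw [← hb, jacobianOperators_mk]
    choose c hc using hdvd
    exact ⟨b, c, hb1, hb2, fun i => by rw [← hc]; ring⟩
  · rintro ⟨β, c, h1, h2, h3⟩
    refine cochainOfVector_mem_range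
      (β := fun i j => Ideal.Quotient.mk (Ideal.span {f}) (β i j)) ?_ ?_ ?_
    · intro i j
      change _ = -Ideal.Quotient.mk (Ideal.span {f}) (β j i)
      rw [h1 i j, map_neg]
    · intro i
      simp [h2]
    · intro i
      have hf : Ideal.Quotient.mk (Ideal.span {f}) f = 0 :=
        Ideal.Quotient.eq_zero_iff_mem.2 (Ideal.mem_span_singleton_self f)
      rw [residueVector_apply, h3, map_add, map_mul, hf, zero_mul, add_zero, map_sum]
      exact Finset.sum_congr rfl fun j _ => (jacobianOperators_mk f j _).symm

/-- The vectors that are Koszul cycles of the partial derivatives modulo `f`. -/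
def jacobianCycles (f : MvPolynomial (Fin n) K) :
    Submodule (MvPolynomial (Fin n) K) (Fin n → MvPolynomial (Fin n) K) :=
  Submodule.comap (∑ i, (LinearMap.proj i).smulRight (pderiv i f)) (Ideal.span {f})

theorem mem_jacobianCycles {f : MvPolynomial (Fin n) K} {a : Fin n → MvPolynomial (Fin n) K} :
    a ∈ jacobianCycles f ↔ f ∣ ∑ i, a i * pderiv i f := by
  rw [jacobianCycles, Submodule.mem_comap, ← Ideal.mem_span_singleton]
  simp

/-- The ideal generated by `f` and its partial derivatives annihilates the first Koszul homology of
the partial derivatives modulo `f`. -/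
theorem span_smul_jacobianCycles_le (f : MvPolynomial (Fin n) K) :
    Ideal.span (insert f (Set.range fun i => pderiv i f)) • jacobianCycles f ≤
      jacobianBoundaries f := by
  rw [Submodule.smul_le]
  intro r hr a ha
  obtain ⟨q, hq⟩ := mem_jacobianCycles.1 ha
  induction hr using Submodule.span_induction with
  | zero => rw [zero_smul]; exact zero_mem _
  | add x y _ _ hx hy => rw [add_smul]; exact add_mem hx hy
  | smul c x _ hx => rw [smul_eq_mul, mul_smul]; exact Submodule.smul_mem _ c hx
  | mem x hx =>
    rcases hx with rfl | ⟨k, rfl⟩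
    · exact ⟨0, a, by simp, by simp, by simp⟩
    -- The Koszul homotopy: `∂ₖ f * a i` equals the contraction of this array with the gradient,
    -- plus `∑ a j * ∂ⱼ f = f * q` when `i = k`.
    · refine ⟨fun i j => (if j = k then a i else 0) - if i = k then a j else 0,
        fun i => if i = k then q else 0, fun i j => by ring, fun i => by ring, fun i => ?_⟩
      simp only [sub_mul, Finset.sum_sub_distrib, ite_mul, zero_mul, Finset.sum_ite_eq',
        Finset.mem_univ, if_true, Pi.smul_apply, smul_eq_mul]
      split_ifs with h
      · rw [hq]; ring
      · simp [mul_comm]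

/-- In high degrees, cycles of the partial derivatives modulo `f` are boundaries. -/
theorem exists_forall_mem_jacobianBoundaries {w : Fin n → ℕ} {d : ℕ} (hd : 1 ≤ d)
    {f : MvPolynomial (Fin n) K} {L : ℕ}
    (hL : idealOfVars (Fin n) K ^ L ≤ Ideal.span (insert f (Set.range fun i => pderiv i f))) :
    ∃ N, ∀ ν, N ≤ ν → ∀ a ∈ poleNumerators K w d ν, a ∈ jacobianCycles f →
      a ∈ jacobianBoundaries f := by
  -- Artin–Rees: a cycle with entries in the power `L + k` lies in the `L`-th power times the module
  -- of cycles, hence in the boundaries.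
  obtain ⟨k, hk⟩ := (idealOfVars (Fin n) K).exists_pow_inf_eq_pow_smul (jacobianCycles f)
  refine ⟨(L + k) * ∑ i, w i + ∑ i, w i + 1, fun ν hν a ha hac => ?_⟩
  have hmem : ∀ i, a i ∈ idealOfVars (Fin n) K ^ (L + k) := by
    intro i
    refine (mem_poleNumerators.1 ha i).mem_pow_idealOfVars (W := ∑ i, w i)
      (fun i => Finset.single_le_sum (fun _ _ => Nat.zero_le _) (Finset.mem_univ i)) ?_
    have h1 : ν ≤ ν * d := Nat.le_mul_of_pos_right ν hd
    have h2 := hν.trans h1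
    zify at h2
    push_cast
    have h3 : (0 : ℤ) ≤ w i := by positivity
    linarith
  have htop : a ∈ idealOfVars (Fin n) K ^ (L + k) •
      (⊤ : Submodule (MvPolynomial (Fin n) K) (Fin n → MvPolynomial (Fin n) K)) := by
    rw [pi_eq_sum_univ a]
    exact Submodule.sum_mem _ fun i _ => Submodule.smul_mem_smul (hmem i) Submodule.mem_top
  have h := hk (L + k) (Nat.le_add_left k L)
  rw [Nat.add_sub_cancel] at h
  have ha' : a ∈ idealOfVars (Fin n) K ^ L •
      (idealOfVars (Fin n) K ^ k • ⊤ ⊓ jacobianCycles f) := h ▸ ⟨htop, hac⟩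
  exact span_smul_jacobianCycles_le f (Submodule.smul_mono hL inf_le_right ha')

end ResidueVector

/-! ### The residue class and lowering of the pole order -/

section Residue

variable {K : Type*} [Field K] {n : ℕ}

/-- Closedness read modulo `f` leaves `(μ + 1) * ∑ a i * ∂ᵢ f`, and `μ + 1` is invertible. -/
theorem mem_jacobianCycles_of_mem_poleCocycles [CharZero K] {w : Fin n → ℕ} {d μ : ℕ}
    {f : MvPolynomial (Fin n) K} (hf0 : f ≠ 0) {a : Fin n → MvPolynomial (Fin n) K}
    (ha : a ∈ poleCocycles w d f (μ + 1)) : a ∈ jacobianCycles f := by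
  obtain ⟨q, hq⟩ := (operatorDiv_polarVector_eq_zero_iff hf0 _ a).1 ha.2
  rw [divNumerator_eq] at hq
  rw [mem_jacobianCycles]
  have hν : ((μ + 1 : ℕ) : K) ≠ 0 := Nat.cast_ne_zero.2 (Nat.succ_ne_zero μ)
  have h1 : f ∣ ((μ + 1 : ℕ) : MvPolynomial (Fin n) K) * ∑ i, a i * pderiv i f :=
    ⟨∑ i, pderiv i (a i) - f ^ (μ + 1) * q, by linear_combination -hq⟩
  have h2 := h1.mul_left (C ((μ + 1 : ℕ) : K)⁻¹)
  rwa [← map_natCast (C : K →+* MvPolynomial (Fin n) K) (μ + 1), ← mul_assoc, ← map_mul,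
    inv_mul_cancel₀ hν, map_one, one_mul] at h2

/-- Two distinct indices and `n ≠ 2` force a third one, of positive weight. This is what excludes
constant `β i j` at pole order one. -/
theorem add_weight_lt_sum {n : ℕ} (hn2 : n ≠ 2) {w : Fin n → ℕ} (hw : ∀ i, 0 < w i) {i j : Fin n}
    (hij : i ≠ j) : w i + w j < ∑ k, w k := by
  have h1 : 1 < n := by
    have := i.2; have := j.2; have := Fin.val_ne_of_ne hij; omega
  have hcard : ({i, j} : Finset (Fin n)).card < (Finset.univ : Finset (Fin n)).card := by
    rw [Finset.card_pair hij, Finset.card_univ, Fintype.card_fin]; omega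
  obtain ⟨l, -, hl⟩ := Finset.exists_mem_notMem_of_card_lt_card hcard
  rw [← Finset.sum_pair hij]
  exact Finset.sum_lt_sum_of_subset (Finset.subset_univ _) (Finset.mem_univ l) hl (hw l)
    fun _ _ _ => Nat.zero_le _

/-- Homogeneous boundaries modulo `f` have homogeneous witnesses. -/
theorem exists_homogeneous_of_mem_jacobianBoundaries {w : Fin n → ℕ} {d μ : ℕ}
    {f : MvPolynomial (Fin n) K} (hf : IsWeightedHomogeneous (fun i => (w i : ℤ)) f (d : ℤ))
    {a : Fin n → MvPolynomial (Fin n) K} (ha : a ∈ poleNumerators K w d (μ + 1))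
    (hab : a ∈ jacobianBoundaries f) :
    ∃ (β : Fin n → Fin n → MvPolynomial (Fin n) K) (c : Fin n → MvPolynomial (Fin n) K),
      (∀ i j, β i j = -β j i) ∧ (∀ i, β i i = 0) ∧
      (∀ i j, IsWeightedHomogeneous (fun i => (w i : ℤ)) (β i j)
        ((μ : ℤ) * d - ∑ k, (w k : ℤ) + w i + w j)) ∧
      c ∈ poleNumerators K w d μ ∧ ∀ i, a i = ∑ j, β i j * pderiv j f + f * c i := by
  obtain ⟨β, c, h1, h2, h3⟩ := hab
  let π : ℤ → MvPolynomial (Fin n) K →ₗ[K] MvPolynomial (Fin n) K :=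
    weightedHomogeneousComponent (fun i => (w i : ℤ))
  let D : ℤ := (μ : ℤ) * d - ∑ k, (w k : ℤ)
  refine ⟨fun i j => π (D + w i + w j) (β i j), fun i => π (D + w i) (c i), fun i j => ?_,
    fun i => by simp [h2], fun i j => weightedHomogeneousComponent_mem (fun i => (w i : ℤ)) _ _,
    mem_poleNumerators.2 fun i => weightedHomogeneousComponent_mem (fun i => (w i : ℤ)) _ _,
    fun i => ?_⟩
  · change _ = -π (D + w j + w i) (β j i)
    rw [← map_neg, ← h1 i j, add_right_comm D]
  · have hai : π (d + (D + w i)) (a i) = a i := by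
      apply IsWeightedHomogeneous.weightedHomogeneousComponent_same
      convert mem_poleNumerators.1 ha i using 1
      simp only [D]
      push_cast
      ring
    rw [← hai, h3, map_add, map_sum]
    refine congr_arg₂ (· + ·) (Finset.sum_congr rfl fun j _ => ?_)
      (weightedHomogeneousComponent_mul_left hf _ _)
    refine (weightedHomogeneousComponent_mul_pderiv hf _ _ _).trans ?_
    rw [add_sub_cancel_left]

theorem MvPolynomial.pderiv_pderiv_comm {σ : Type*} (i j : σ) (p : MvPolynomial σ K) :
    pderiv i (pderiv j p) = pderiv j (pderiv i p) := by
  classical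
  ext m
  simp only [coeff_pderiv, add_right_comm m (Finsupp.single i 1)]
  by_cases h : i = j
  · rw [h]
  · simp [h, Ne.symm h]
    ring

theorem deRhamOperators_comm (f : MvPolynomial (Fin n) K) (i j : Fin n)
    (x : LocalCohomologyOne K f) :
    deRhamOperators f i (deRhamOperators f j x) = deRhamOperators f j (deRhamOperators f i x) :=
  derivLocalCohomologyOne_comm (fun _ => MvPolynomial.pderiv_pderiv_comm _ _ _) f x

/-- If the leading coefficients of a closed form with pole of order `μ + 1` form a Koszul boundary
modulo `f`, then the pole order can be lowered without changing the de Rham class. -/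
theorem poleClass_mem_range_of_mem_jacobianBoundaries [CharZero K] (hn2 : n ≠ 2) {w : Fin n → ℕ}
    (hw : ∀ i, 0 < w i) {d μ : ℕ} {f : MvPolynomial (Fin n) K}
    (hf : IsWeightedHomogeneous (fun i => (w i : ℤ)) f (d : ℤ))
    (a : poleCocycles w d f (μ + 1))
    (hab : (a : Fin n → MvPolynomial (Fin n) K) ∈ jacobianBoundaries f) :
    poleClass w d f (μ + 1) a ∈ LinearMap.range (poleClass w d f μ) := by
  obtain ⟨a, ha⟩ := a
  obtain ⟨β, c, h1, h2, h3, h4, h5⟩ := exists_homogeneous_of_mem_jacobianBoundaries hf ha.1 hab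
  -- For `μ = 0` the off-diagonal `β i j` have negative degree, so `f` divides each `a i` and the
  -- form has no pole.
  rcases Nat.eq_zero_or_pos μ with rfl | hμ
  · have hβ : ∀ i j, β i j = 0 := by
      intro i j
      by_cases hij : i = j
      · rw [hij, h2]
      · refine (h3 i j).eq_zero_of_neg ?_
        have := add_weight_lt_sum hn2 hw hij
        zify at this
        simp only [Nat.cast_zero, zero_mul]
        linarith
    have hv : polarVector f (0 + 1) a = 0 := by
      funext i
      rw [polarVector_apply, h5, polarPart_apply]
      simp only [hβ, zero_mul, Finset.sum_const_zero, zero_add]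
      rw [← polarPart_apply (K := K)]
      exact (polarPart_succ_mul f (c i) 0).trans (polarPart_zero f _)
    have : poleClass w d f (0 + 1) ⟨a, ha⟩ = 0 :=
      (poleClass_eq_of_sub_mem_range _ 0 (by simp [hv])).trans (map_zero _)
    rw [this]
    exact zero_mem _
  · have hμK : (μ : K) ≠ 0 := Nat.cast_ne_zero.2 hμ.ne'
    -- The leading term of `∂ⱼ (β i j / f ^ μ)` is `-μ * β i j * ∂ⱼ f / f ^ (μ + 1)`, hence the
    -- factor `-μ⁻¹`. The other term has pole order `μ` and is absorbed into `a'`.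
    let γ : Fin n → Fin n → LocalCohomologyOne K f := fun i j =>
      -((μ : K)⁻¹ • polarPart K f μ (β i j))
    let a' : Fin n → MvPolynomial (Fin n) K := fun i => c i + (μ : K)⁻¹ • ∑ j, pderiv j (β i j)
    have hγ1 : ∀ i j, γ i j = -γ j i := fun i j => by
      simp only [γ]; rw [h1 i j, map_neg, smul_neg]
    have hγ2 : ∀ i, γ i i = 0 := fun i => by simp [γ, h2]
    have hγ : polarVector f (μ + 1) a - polarVector f μ a' =
        fun i => ∑ j, deRhamOperators f j (γ i j) := by
      funext i
      have h6 : ∑ j, deRhamOperators f j (γ i j) =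
          -((μ : K)⁻¹ • polarPart K f (μ + 1) (divNumerator f μ (β i))) := by
        simp only [γ, map_neg, map_smul]
        rw [Finset.sum_neg_distrib, ← Finset.smul_sum, sum_deRhamOperators_polarPart]
      have h7 : divNumerator f μ (β i) =
          f * ∑ j, pderiv j (β i j) - (μ : K) • (a i - f * c i) := by
        rw [divNumerator_eq, h5, add_sub_cancel_right, Nat.cast_smul_eq_nsmul, nsmul_eq_mul]
      rw [h6, h7, Pi.sub_apply, polarVector_apply, polarVector_apply, map_sub, map_smul, map_sub,
        polarPart_succ_mul, polarPart_succ_mul, map_add, map_smul, smul_sub, smul_smul,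
        inv_mul_cancel₀ hμK, one_smul]
      abel
    have ha' : a' ∈ poleCocycles w d f μ := by
      refine mem_poleCocycles.2 ⟨mem_poleNumerators.2 fun i => ?_, ?_⟩
      · refine (mem_poleNumerators.1 h4 i).add ?_
        refine Submodule.smul_mem (weightedHomogeneousSubmodule K _ _) _
          (Submodule.sum_mem _ fun j _ => ?_)
        exact (h3 i j).pderiv rfl
      · have := operatorDiv_skew (deRhamOperators_comm f) hγ1
        rw [← hγ, map_sub, (mem_poleCocycles.1 ha).2, zero_sub, neg_eq_zero] at this
        exact this
    refine ⟨⟨a', ha'⟩, poleClass_eq_of_sub_mem_range _ ⟨polarVector f (μ + 1) a, ha.2⟩ ?_⟩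
    exact cochainOfVector_mem_range hγ1 hγ2 (congr_fun hγ)

/-- The Koszul class in `A = R/(f)` of the leading coefficients of a closed form with a pole. -/
def residueClass [CharZero K] (w : Fin n → ℕ) (d : ℕ) {f : MvPolynomial (Fin n) K} (hf0 : f ≠ 0)
    (μ : ℕ) : poleCocycles w d f (μ + 1) →ₗ[K] KoszulCohomology (jacobianOperators f) (n - 1) :=
  koszulClass (jacobianOperators f) ∘ₗ (residueVector f).restrict fun a ha => by
    rw [LinearMap.mem_ker, operatorDiv_residueVector, Ideal.Quotient.eq_zero_iff_mem,
      Ideal.mem_span_singleton]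
    exact mem_jacobianCycles.1 (mem_jacobianCycles_of_mem_poleCocycles hf0 ha)

theorem residueClass_eq_zero_iff [CharZero K] {w : Fin n → ℕ} {d : ℕ} {f : MvPolynomial (Fin n) K}
    (hf0 : f ≠ 0) {μ : ℕ} (a : poleCocycles w d f (μ + 1)) :
    residueClass w d hf0 μ a = 0 ↔
      (a : Fin n → MvPolynomial (Fin n) K) ∈ jacobianBoundaries f :=
  (koszulClass_eq_zero_iff _).trans cochainOfVector_residueVector_mem_range_iff

/-- At the complement of `i` the required degree is `(μ + 2) * d - ω - (d - w i)`, which is that of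
`a i`. -/
theorem residueClass_mem [CharZero K] {w : Fin n → ℕ} {d : ℕ} {f : MvPolynomial (Fin n) K}
    (hf0 : f ≠ 0) {μ : ℕ} (a : poleCocycles w d f (μ + 1)) :
    residueClass w d hf0 μ a ∈ koszulCohomologyOfDegree (jacobianOperators f) (n - 1)
      (HypersurfaceRing.component w f) (fun i => (d : ℤ) - (w i : ℤ))
      ((((μ + 1 : ℕ) : ℤ) + 1) * (d : ℤ) - ∑ i, (w i : ℤ)) := by
  refine Submodule.mem_map_of_mem ?_
  change cochainOfVector K _ n (residueVector f a) ∈ koszulCochainsOfDegree _ _ _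
  intro S
  by_cases hS : ∃ i, S = {i}ᶜ
  · obtain ⟨i, rfl⟩ := hS
    rw [cochainOfVector_compl, compl_compl, Finset.sum_singleton]
    refine zsmul_mem (Submodule.mem_map_of_mem ?_) _
    rw [mem_weightedHomogeneousSubmodule]
    convert mem_poleNumerators.1 a.2.1 i using 1
    ring
  · push Not at hS
    rw [cochainOfVector_of_ne _ hS]
    exact zero_mem _

theorem exists_injective_of_range_poleClass [CharZero K] (hn2 : n ≠ 2) {w : Fin n → ℕ}
    (hw : ∀ i, 0 < w i) {d ν μ : ℕ} (hν : ν = μ + 1) {f : MvPolynomial (Fin n) K} (hf0 : f ≠ 0)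
    (hf : IsWeightedHomogeneous (fun i => (w i : ℤ)) f (d : ℤ)) :
    ∃ η : (LinearMap.range (poleClass w d f ν) ⧸
        (LinearMap.range (poleClass w d f μ)).submoduleOf (LinearMap.range (poleClass w d f ν)))
          →ₗ[K]
        koszulCohomologyOfDegree (jacobianOperators f) (n - 1)
          (HypersurfaceRing.component w f) (fun i => (d : ℤ) - (w i : ℤ))
          (((ν : ℤ) + 1) * (d : ℤ) - ∑ i, (w i : ℤ)),
      Function.Injective η := by
  subst hν
  exact LinearMap.exists_injective_quotient_range (poleClass w d f (μ + 1))
    (residueClass w d hf0 μ) (residueClass_mem hf0) fun a ha =>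
      poleClass_mem_range_of_mem_jacobianBoundaries hn2 hw hf a
        ((residueClass_eq_zero_iff hf0 a).1 ha)

/-- With positive weights only constants have degree zero. -/
theorem MvPolynomial.IsWeightedHomogeneous.eq_zero_or_isUnit {w : Fin n → ℕ} (hw : ∀ i, 0 < w i)
    {f : MvPolynomial (Fin n) K} (hf : IsWeightedHomogeneous w f 0) : f = 0 ∨ IsUnit f := by
  have h : f = C (coeff 0 f) := by
    ext m
    rw [coeff_C]
    split_ifs with hm
    · rw [hm]
    · by_contra hne
      apply hm
      have hwt := hf hne
      ext i
      by_contra hi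
      have := Finsupp.le_weight_of_ne_zero' w (s := i) (f := m) (fun h => hi (by simp [h]))
      have := hw i
      omega
  by_cases h0 : coeff 0 f = 0
  · left; rw [h, h0, map_zero]
  · right; rw [h]; exact (IsUnit.mk0 _ h0).map C

theorem monotone_range_poleClass {w : Fin n → ℕ} {d : ℕ} {f : MvPolynomial (Fin n) K}
    (hf : IsWeightedHomogeneous (fun i => (w i : ℤ)) f (d : ℤ)) :
    Monotone fun ν => LinearMap.range (poleClass w d f ν) :=
  monotone_nat_of_le_succ (range_poleClass_le_succ hf)

/-- For an isolated singularity, the filtration by the order of the pole is exhausted after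
finitely many steps. -/
theorem exists_forall_range_poleClass_eq_top [CharZero K] (hn : 1 ≤ n) (hn2 : n ≠ 2)
    {w : Fin n → ℕ} (hw : ∀ i, 0 < w i) {d : ℕ} (hd : 1 ≤ d) {f : MvPolynomial (Fin n) K}
    (hf0 : f ≠ 0) (hf : IsWeightedHomogeneous w f d)
    (hA : HypersurfaceRing.IsIsolatedSingularity w f) :
    ∃ N, ∀ ν, N ≤ ν → LinearMap.range (poleClass w d f ν) = ⊤ := by
  have hfZ := hf.natCast_weights
  have hmono := monotone_range_poleClass hfZ
  obtain ⟨L, hL⟩ := hA.exists_pow_idealOfVars_le hf0 hf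
  obtain ⟨N, hN⟩ := exists_forall_mem_jacobianBoundaries (w := w) hd hL
  -- Beyond `N` every residue class vanishes, so the pole order descends one step at a time to `N`.
  have hstep : ∀ k, LinearMap.range (poleClass w d f (N + k)) ≤
      LinearMap.range (poleClass w d f N) := by
    intro k
    induction k with
    | zero => exact le_rfl
    | succ k ih =>
      refine le_trans ?_ ih
      rintro _ ⟨a, rfl⟩
      exact poleClass_mem_range_of_mem_jacobianBoundaries hn2 hw hfZ a
        (hN _ (by omega) _ a.2.1 (mem_jacobianCycles_of_mem_poleCocycles hf0 a.2))
  refine ⟨N, fun ν hν => eq_top_iff.2 fun x _ => ?_⟩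
  obtain ⟨k, hk⟩ := exists_mem_range_poleClass hn hf0 hfZ x
  exact hmono hν (hstep k (hmono (Nat.le_add_left k N) hk))

end Residue

end

theorem theorem2 {K : Type*} [Field K] [CharZero K] (n : ℕ) (hn : 1 ≤ n) (hn2 : n ≠ 2)
    (w : Fin n → ℕ) (hw : ∀ i, 0 < w i)
    (f : MvPolynomial (Fin n) K) (d : ℕ) (hf : MvPolynomial.IsWeightedHomogeneous w f d)
    (hA : HypersurfaceRing.IsIsolatedSingularity w f) :
    ∃ F : ℕ → Submodule K (KoszulCohomology (deRhamOperators f) (n - 1)),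
      F 0 = ⊥ ∧
      (∀ ν : ℕ, 1 ≤ ν → F (ν - 1) ≤ F ν) ∧
      (∃ N : ℕ, ∀ ν : ℕ, N ≤ ν → F ν = ⊤) ∧
      ∀ ν : ℕ, 1 ≤ ν →
        ∃ η : (F ν ⧸ (F (ν - 1)).submoduleOf (F ν)) →ₗ[K]
            koszulCohomologyOfDegree (jacobianOperators f) (n - 1)
              (HypersurfaceRing.component w f) (fun i => (d : ℤ) - (w i : ℤ))
              (((ν : ℤ) + 1) * (d : ℤ) - ∑ i, (w i : ℤ)),
          Function.Injective η := by
  -- In these cases local cohomology is zero; otherwise `f ≠ 0` and `d ≥ 1`, as the pole-order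
  -- argument requires.
  by_cases htriv : f = 0 ∨ IsUnit f
  · have := subsingleton_localCohomologyOne (K := K) htriv
    have hsub : Subsingleton (KoszulCohomology (deRhamOperators f) (n - 1)) :=
      (Submodule.mkQ_surjective _).subsingleton
    exact ⟨fun _ => ⊥, rfl, fun _ _ => le_rfl, ⟨0, fun _ _ => Subsingleton.elim _ _⟩,
      fun ν _ => ⟨0, Function.injective_of_subsingleton _⟩⟩
  have hf0 : f ≠ 0 := fun h => htriv (Or.inl h)
  have hd : 1 ≤ d := Nat.one_le_iff_ne_zero.2 fun h => htriv ((h ▸ hf).eq_zero_or_isUnit hw)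
  have hfZ := hf.natCast_weights
  have htop := exists_forall_range_poleClass_eq_top hn hn2 hw hd hf0 hf hA
  have hmono := monotone_range_poleClass hfZ
  refine ⟨fun ν => LinearMap.range (poleClass w d f ν), ?_, fun ν _ => hmono (Nat.sub_le ν 1),
    htop, fun ν hν => ?_⟩
  · simp only [poleClass_zero, LinearMap.range_zero]
  · exact exists_injective_of_range_poleClass hn2 hw (Nat.sub_add_cancel hν).symm hf0 hfZ
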